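/- Let $K/k$ be a finite Galois extension of number fields with Galois group $G$, and let $S$ be a finite $G$-stable set of places of $K$ containing all Archimedean places. For $H\le G$ let $S(K^H)$ be the set of places of $K^H$ below those in $S$, let $\mathcal O_{K^H,S}^\times$ be the group of $S(K^H)$-units of $K^H$, $h_S(K^H)$ the $S(K^H)$-class number of $K^H$ and $w(K^H)$ the number of roots of unity in $K^H$. For $\mathfrak p\in S(K^H)$ let $f_{\mathfrak p}=[K_{\mathfrak P}:K^H_{\mathfrak p}]$ be the local degree at any place $\mathfrak P$ of $K$ above $\mathfrak p$ (for finite $\mathfrak p$ unramified in $K$ this is the residue field degree), and put $$n(H)=\prod_{\mathfrak p\in S(K^H)}f_{\mathfrak p},\qquad l(H)=\operatorname{lcm}\{f_{\mathfrak p}\mid \mathfrak p\in S(K^H)\}.$$ Let $I_{K,S}$ be the kernel of the augmentation map $\mathbb Z[S]\to\mathbb Z$ that sends every $v\in S$ to $1$. For every $\mathfrak p\in S(k)$ let $D_{\mathfrak p}\le G$ be the decomposition group of a chosen place in $S$ above $\mathfrak p$. A function $f$ from the set of subgroups of $G$ to an abelian group $X$ is called factorisable if there are an injective homomorphism of abelian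 groups $\iota:X\to Y$ and a function $g:\mathrm{Irr}(G)\to Y$ on the irreducible complex characters of $G$ with $\iota(f(H))=\prod_{\chi}g(\chi)^{\langle\chi,\mathbb C[G/H]\rangle}$ for all $H\le G$. A Brauer relation is a formal sum $\Theta=\sum_{H\le G}n_HH$ with $n_H\in\mathbb Z$ such that $\bigoplus_{n_H>0}\mathbb Q[G/H]^{n_H}\cong\bigoplus_{n_H<0}\mathbb Q[G/H]^{-n_H}$ as $\mathbb Q[G]$-modules. For a finitely generated $\mathbb Z[G]$-module $M$ the regulator constant is $$\mathcal C_\Theta(M)=\prod_{H\le G}\det\Bigl(\tfrac1{|H|}\langle\cdot,\cdot\rangle\,\Big|\,M^H/\mathrm{tors}\Bigr)^{n_H},$$ where $\langle\cdot,\cdot\rangle:M\times M\to\mathbb C$ is any $G$-invariant bilinear pairing that is non-degenerate on $M/\mathrm{tors}$ (the value does not depend on it). Write $\mathrm{triv}$ for $\mathbb Z$ with trivial $G$-action. (1) For every Brauer relation $\Theta=\sum_H n_HH$, $$\mathcal C_\Theta(I_{K,S})=\frac{\mathcal C_\Theta(\mathrm{triv})}{\prod_{\mathfrak p\in S(k)}\mathcal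 C_\Theta(\mathbb Z[G/D_{\mathfrak p}])}\prod_{H}\left(\frac{l(H)}{n(H)}\right)^{2n_H}.$$ (2) Let $i:I_{K,S}\hookrightarrow\mathcal O_{K,S}^\times$ be any embedding of $G$-modules with finite cokernel. Then the following two statements are equivalent. (a) The function $$H\mapsto[\mathcal O_{K^H,S}^\times:i(I_{K,S})^H]\,\frac{n(H)}{h_S(K^H)\,l(H)}\in\mathbb Q^\times$$ is factorisable. (b) For every Brauer relation $\Theta=\sum_H n_HH$, $$\mathcal C_\Theta(\mathcal O_{K,S}^\times)=\frac{\mathcal C_\Theta(\mathrm{triv})}{\prod_{\mathfrak p\in S(k)}\mathcal C_\Theta(\mathbb Z[G/D_{\mathfrak p}])}\prod_{H}\left(\frac{w(K^H)}{h_S(K^H)}\right)^{2n_H}.$$ -/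

import Mathlib

open NumberField IsDedekindDomain
open scoped Pointwise

universe u

namespace FactorReg

noncomputable section

/-! ### Factorisability -/

section Factorisability

variable (G : Type*) [Group G]

/-- The set `Irr(G)` of irreducible complex characters of `G`. -/
def Irr : Type _ :=
  {χ : G → ℂ // ∃ (n : ℕ) (ρ : Representation ℂ G (Fin n → ℂ)), ρ.IsIrreducible ∧ ρ.character = χ}

variable {G}

/-- The usual inner product of class functions, `|G|⁻¹ ∑ χ(g) conj(ψ(g))`. -/
def charInner (χ ψ : G → ℂ) : ℂ :=
  (Nat.card G : ℂ)⁻¹ * ∑ᶠ g : G, χ g * star (ψ g)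

/-- The character of the permutation representation `ℂ[G/H]`. -/
def permChar (H : Subgroup G) : G → ℂ :=
  (Representation.ofMulAction ℂ G (G ⧸ H)).character

/-- A function `f` on the subgroups of `G` with values in an abelian group `X` is factorisable if
there are an injection `ι : X → Y` of abelian groups and a function `g : Irr(G) → Y` such that
`ι (f H) = ∏_χ g(χ) ^ ⟨χ, ℂ[G/H]⟩` for all `H ≤ G`. The natural numbers `m χ H` are the inner
products `⟨χ, ℂ[G/H]⟩`, which are complex numbers by definition. -/
def IsFactorisable {X : Type u} [CommGroup X] (f : Subgroup G → X) : Prop :=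
  ∃ m : Irr G → Subgroup G → ℕ,
    (∀ (χ : Irr G) (H : Subgroup G), (m χ H : ℂ) = charInner χ.1 (permChar H)) ∧
    ∃ (Y : Type u) (_ : CommGroup Y) (ι : X →* Y) (g : Irr G → Y),
      Function.Injective ι ∧ ∀ H : Subgroup G, ι (f H) = ∏ᶠ χ : Irr G, g χ ^ m χ H

end Factorisability

/-! ### Brauer relations and regulator constants -/

section RegulatorConstants

variable {G : Type*} [Group G]

/-- The formal integral combination `Θ = ∑ Θ(H) H` of subgroups is a Brauer relation if
`⨁_{Θ(H) > 0} ℚ[G/H]^{Θ(H)}` and `⨁_{Θ(H) < 0} ℚ[G/H]^{-Θ(H)}` are isomorphic. Each of the two is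
written as the permutation representation on the corresponding disjoint union of `G`-sets `G/H`. -/
def IsBrauerRelation (Θ : Subgroup G → ℤ) : Prop :=
  Nonempty <| Representation.Equiv
    (Representation.ofMulAction ℚ G (Σ j : (Σ H : Subgroup G, Fin (Θ H).toNat), G ⧸ j.1))
    (Representation.ofMulAction ℚ G (Σ j : (Σ H : Subgroup G, Fin (-Θ H).toNat), G ⧸ j.1))

/-- The determinant of the bilinear form induced by `B` on the lattice `N/tors`: the determinant of
the Gram matrix of `B` with respect to lifts to `N` of a `ℤ`-basis of `N/tors`. (As `ℂ` is torsion
free, it does not depend on the lifts, and it is clearly independent of the basis.) -/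
def latticeDet (N : Type*) [AddCommGroup N] [Module.Finite ℤ N] (B : N →ₗ[ℤ] N →ₗ[ℤ] ℂ) : ℂ :=
  let b := Module.finBasis ℤ (N ⧸ Submodule.torsion ℤ N)
  Matrix.det (Matrix.of fun i j => B (b i).out (b j).out)

variable {M : Type*} [AddCommGroup M] [Module.Finite ℤ M]

/-- A `G`-invariant bilinear pairing `M × M → ℂ` which is non-degenerate on `M/tors`. -/
def IsInvariantPairing (ρ : Representation ℤ G M) (B : M →ₗ[ℤ] M →ₗ[ℤ] ℂ) : Prop :=
  (∀ g x y, B (ρ g x) (ρ g y) = B x y) ∧ latticeDet M B ≠ 0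

theorem exists_isInvariantPairing [Finite G] (ρ : Representation ℤ G M) :
    ∃ B : M →ₗ[ℤ] M →ₗ[ℤ] ℂ, IsInvariantPairing ρ B := by
  classical
  have := Fintype.ofFinite G
  let b := Module.finBasis ℤ (M ⧸ Submodule.torsion ℤ M)
  let c : G → Fin _ → M →ₗ[ℤ] ℤ := fun g i =>
    b.coord i ∘ₗ (Submodule.torsion ℤ M).mkQ ∘ₗ ρ g
  let B : M →ₗ[ℤ] M →ₗ[ℤ] ℂ := LinearMap.mk₂ ℤ
    (fun x y => ((∑ g, ∑ i, c g i x * c g i y : ℤ) : ℂ))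
    (by intro x x' y; simp [add_mul, Finset.sum_add_distrib])
    (by intro a x y; simp [mul_assoc, Finset.mul_sum])
    (by intro x y y'; simp [mul_add, Finset.sum_add_distrib])
    (by intro a x y; simp [mul_left_comm, Finset.mul_sum])
  have hB : ∀ x y, B x y = ((∑ g, ∑ i, c g i x * c g i y : ℤ) : ℂ) := fun x y => rfl
  refine ⟨B, fun g x y => ?_, ?_⟩
  · rw [hB, hB]
    congr 1
    refine Fintype.sum_equiv (Equiv.mulRight g) _ _ fun h => ?_
    simp [c]
  · let A : G → Matrix (Fin _) (Fin _) ℤ := fun g => Matrix.of fun i j => c g i (b j).out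
    let D : Matrix (Fin _) (Fin _) ℤ := ∑ g, (A g).transpose * A g
    have hA1 : A 1 = 1 := by
      ext i j
      have : (Submodule.torsion ℤ M).mkQ (b j).out = b j := Quotient.out_eq' (b j)
      simp only [A, c, Matrix.of_apply, LinearMap.comp_apply, map_one, Module.End.one_apply, this]
      simp [Matrix.one_apply, Finsupp.single_apply, eq_comm]
    have h1 : latticeDet M B = ((D.det : ℤ) : ℂ) := by
      rw [Int.cast_det]
      refine congrArg Matrix.det (Matrix.ext fun i j => ?_)
      simp [hB, D, A, Matrix.sum_apply, Matrix.mul_apply, b]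
    rw [h1, Int.cast_ne_zero]
    intro h0
    obtain ⟨v, hv, hDv⟩ := Matrix.exists_mulVec_eq_zero_iff.mpr h0
    have h2 : ∑ g, (A g).mulVec v ⬝ᵥ (A g).mulVec v = 0 := by
      have h3 : v ⬝ᵥ D.mulVec v = 0 := by rw [hDv, dotProduct_zero]
      rw [← h3, Matrix.sum_mulVec, dotProduct_sum]
      refine Finset.sum_congr rfl fun g _ => ?_
      rw [← Matrix.mulVec_mulVec, Matrix.dotProduct_mulVec v, Matrix.vecMul_transpose]
    have h4 := (Finset.sum_eq_zero_iff_of_nonneg (fun g _ =>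
      Finset.sum_nonneg fun i _ => mul_self_nonneg ((A g).mulVec v i))).mp h2 1 (Finset.mem_univ _)
    rw [hA1, Matrix.one_mulVec] at h4
    exact hv (dotProduct_self_eq_zero.mp h4)

/-- The submodule `M^H` of `H`-invariants. -/
abbrev fixedBy (ρ : Representation ℤ G M) (H : Subgroup G) : Submodule ℤ M :=
  Representation.invariants (ρ.comp H.subtype)

/-- `∏_H det(|H|⁻¹ ⟨·,·⟩ | M^H/tors) ^ Θ(H)` for a given pairing `⟨·,·⟩ = B`. -/
def regulatorProduct (ρ : Representation ℤ G M) (Θ : Subgroup G → ℤ) (B : M →ₗ[ℤ] M →ₗ[ℤ] ℂ) : ℂ :=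
  ∏ᶠ H : Subgroup G, latticeDet (fixedBy ρ H)
    ((Nat.card H : ℂ)⁻¹ • B.domRestrict₁₂ (fixedBy ρ H) (fixedBy ρ H)) ^ Θ H

/-- The regulator constant `C_Θ(M)`, computed with some invariant pairing on `M` that is
non-degenerate on `M/tors`. (For a Brauer relation it does not depend on the pairing.) -/
def regulatorConstant [Finite G] (ρ : Representation ℤ G M) (Θ : Subgroup G → ℤ) : ℂ :=
  regulatorProduct ρ Θ (exists_isInvariantPairing ρ).choose

end RegulatorConstants

/-! ### Places -/

/-- The places of a number field: the Archimedean and the finite ones. -/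
abbrev Place (F : Type*) [Field F] [NumberField F] : Type _ :=
  InfinitePlace F ⊕ HeightOneSpectrum (𝓞 F)

section Galois

variable {k K : Type*} [Field k] [Field K] [NumberField K] [Algebra k K]

/-- The Galois action on the finite places. On Archimedean places it is the one of Mathlib, and on
`Place K` it is the resulting one. -/
instance : MulAction Gal(K/k) (HeightOneSpectrum (𝓞 K)) where
  smul σ v :=
    { asIdeal := σ • v.asIdeal
      isPrime := by have := v.isPrime; infer_instance
      ne_bot := by
        intro h
        exact v.ne_bot (by rw [← inv_smul_smul σ v.asIdeal, h, Ideal.smul_bot]) }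
  one_smul v := HeightOneSpectrum.ext (one_smul _ v.asIdeal)
  mul_smul σ τ v := HeightOneSpectrum.ext (mul_smul σ τ v.asIdeal)

theorem valuation_smul (σ : Gal(K/k)) (v : HeightOneSpectrum (𝓞 K)) (x : K) :
    (σ • v).valuation K (σ x) = v.valuation K x := by
  have key : ∀ a : 𝓞 K, (σ • v).intValuation (σ • a) = v.intValuation a := by
    intro a
    rcases eq_or_ne a 0 with rfl | ha
    · simp
    have ha' : σ • a ≠ 0 := (smul_ne_zero_iff_ne σ).mpr ha
    rw [HeightOneSpectrum.intValuation_eq_exp_neg_multiplicity _ ha',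
      HeightOneSpectrum.intValuation_eq_exp_neg_multiplicity _ ha]
    have h1 : Ideal.span {σ • a} = σ • Ideal.span {a} := by
      rw [Ideal.pointwise_smul_def, Ideal.map_span, Set.image_singleton]
      rfl
    rw [h1, ← multiplicity_map_eq (MulDistribMulAction.toMulEquiv (Ideal (𝓞 K)) σ)
      (a := v.asIdeal)]
    rfl
  obtain ⟨a, b, hb, rfl⟩ := IsFractionRing.div_surjective (A := 𝓞 K) x
  have h2 : ∀ a : 𝓞 K, σ (algebraMap (𝓞 K) K a) = algebraMap (𝓞 K) K (σ • a) := fun a => rfl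
  rw [map_div₀, h2, h2, map_div₀, map_div₀]
  simp only [HeightOneSpectrum.valuation_of_algebraMap, key]

end Galois

section Fields

variable (F : Type*) {K : Type*} [Field F] [NumberField F] [Field K] [NumberField K] [Algebra F K]

/-- The place of `F` below a place of `K`. -/
def Place.below : Place K → Place F
  | Sum.inl v => Sum.inl (v.comap (algebraMap F K))
  | Sum.inr v => Sum.inr (v.under (𝓞 F))

/-- The set `S(F)` of places of `F` below those in `S`. -/
def placesBelow (S : Set (Place K)) : Set (Place F) := Place.below F '' S

instance (S : Set (Place K)) [Finite S] : Finite (placesBelow F S) :=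
  (Set.toFinite S).image _

variable {F}

variable (K) in
/-- The local degree `[K_𝔓 : F_𝔭]` in the Galois extension `K/F`, where `𝔓` is any place of `K`
above `𝔭`: the product of the ramification index and the residue field degree for finite `𝔭`;
`1` or `2` for Archimedean `𝔭`, according to whether `𝔭` is unramified or ramified in `K`. -/
def localDegree : Place F → ℕ
  | Sum.inl v => open Classical in if v.IsUnramifiedIn K then 1 else 2
  | Sum.inr v => v.asIdeal.ramificationIdxIn (𝓞 K) * v.asIdeal.inertiaDegIn (𝓞 K)

/-- The finite places in a set of places. -/
def finitePart (T : Set (Place F)) : Set (HeightOneSpectrum (𝓞 F)) := {v | Sum.inr v ∈ T}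

instance (T : Set (Place F)) [Finite T] : Finite (finitePart T) :=
  Set.Finite.preimage Sum.inr_injective.injOn (Set.toFinite T)

/-- The group `𝓞_{F,T}ˣ` of `T`-units of `F`, for a set `T` of places of `F`. -/
abbrev sUnits (T : Set (Place F)) : Subgroup Fˣ := (finitePart T).unit F

/-- The group of `T`-units is finitely generated. -/
theorem finite_unit (T : Set (HeightOneSpectrum (𝓞 F))) [Finite T] :
    Module.Finite ℤ (Additive (T.unit F)) := by
  classical
  let f : T.unit F →* (T → Multiplicative ℤ) :=
    { toFun := fun u v => Multiplicative.ofAdd (WithZero.log (v.1.valuation F (u : Fˣ)))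
      map_one' := by ext; simp
      map_mul' := by
        intro x y; ext v
        simp [WithZero.log_mul] }
  let fl : Additive (T.unit F) →ₗ[ℤ] Additive (T → Multiplicative ℤ) :=
    (MonoidHom.toAdditive f).toIntLinearMap
  have hO : ∀ (u : (𝓞 F)ˣ) (v : HeightOneSpectrum (𝓞 F)),
      v.valuation F (algebraMap (𝓞 F) F u) = 1 := by
    intro u v
    rw [HeightOneSpectrum.valuation_eq_one_iff_notMem]
    exact fun h => v.isPrime.ne_top (Ideal.eq_top_of_isUnit_mem _ h u.isUnit)
  let e : (𝓞 F)ˣ →* T.unit F :=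
    (Units.map (algebraMap (𝓞 F) F : 𝓞 F →* F)).codRestrict _ fun u v _ => hO u v
  let el : Additive (𝓞 F)ˣ →ₗ[ℤ] Additive (T.unit F) := (MonoidHom.toAdditive e).toIntLinearMap
  have hker : LinearMap.ker fl ≤ LinearMap.range el := by
    intro u hu
    have hval : ∀ v : HeightOneSpectrum (𝓞 F), v.valuation F ((u.toMul : Fˣ) : F) = 1 := by
      intro v
      by_cases hv : v ∈ T
      · have h1 : f u.toMul = 1 := hu
        have h2 := congrFun h1 ⟨v, hv⟩
        have h3 : WithZero.log (v.valuation F ((u.toMul : Fˣ) : F)) = 0 := h2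
        have h4 : v.valuation F ((u.toMul : Fˣ) : F) ≠ 0 := by simp
        rw [← WithZero.exp_log h4, h3, WithZero.exp_zero]
      · exact u.toMul.2 v hv
    obtain ⟨a, ha⟩ := HeightOneSpectrum.mem_integers_of_valuation_le_one F
      ((u.toMul : Fˣ) : F) fun v => (hval v).le
    obtain ⟨c, hc⟩ := HeightOneSpectrum.mem_integers_of_valuation_le_one F
      (((u.toMul : Fˣ)⁻¹ : Fˣ) : F) fun v => by
        rw [Units.val_inv_eq_inv_val, map_inv₀, hval v, inv_one]
    have hac : a * c = 1 := by
      apply IsFractionRing.injective (𝓞 F) F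
      rw [map_mul, ha, hc, map_one, Units.mul_inv]
    refine ⟨Additive.ofMul ⟨a, c, hac, by rw [mul_comm, hac]⟩, ?_⟩
    apply Additive.toMul.injective
    apply Subtype.ext
    exact Units.ext ha
  have h1 : Module.Finite ℤ (LinearMap.ker fl) :=
    Module.Finite.of_injective (Submodule.inclusion hker) (Submodule.inclusion_injective hker)
  have h0 : Module.Finite ℤ (Additive (T → Multiplicative ℤ)) :=
    inferInstanceAs (Module.Finite ℤ (T → ℤ))
  have h2 : Module.Finite ℤ (Additive (T.unit F) ⧸ LinearMap.ker fl) :=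
    Module.Finite.equiv fl.quotKerEquivRange.symm
  exact Module.Finite.of_submodule_quotient (LinearMap.ker fl)

instance (T : Set (Place F)) [Finite T] : Module.Finite ℤ (Additive (sUnits T)) :=
  finite_unit (finitePart T)

/-- The `T`-class number of `F`: the order of the `T`-class group, which is the quotient of the
ideal class group by the subgroup generated by the classes of the finite primes in `T`. -/
def sClassNumber (T : Set (Place F)) : ℕ :=
  Nat.card (ClassGroup (𝓞 F) ⧸ Subgroup.closure
    {c | ∃ v ∈ finitePart T,
      c = ClassGroup.mk0 ⟨v.asIdeal, mem_nonZeroDivisors_of_ne_zero v.ne_bot⟩})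

end Fields

/-! ### The Galois modules `I_{K,S}` and `𝓞_{K,S}ˣ` -/

section Modules

variable {k K : Type*} [Field k] [Field K] [NumberField K] [Algebra k K]
  (S : SubMulAction Gal(K/k) (Place K))

/-- The kernel `I_{K,S}` of the augmentation `ℤ[S] → ℤ`. -/
def augKernel : Subrepresentation (Representation.ofMulAction ℤ Gal(K/k) S) where
  toSubmodule := LinearMap.ker
    (Finsupp.linearCombination ℤ (fun _ : S => (1 : ℤ)) ∘ₗ
      (MonoidAlgebra.coeffLinearEquiv ℤ).toLinearMap)
  apply_mem_toSubmodule := by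
    intro g x hx
    have h : (Finsupp.linearCombination ℤ (fun _ : S => (1 : ℤ)) ∘ₗ
        (MonoidAlgebra.coeffLinearEquiv ℤ).toLinearMap) ∘ₗ
          Representation.ofMulAction ℤ Gal(K/k) S g =
        Finsupp.linearCombination ℤ (fun _ : S => (1 : ℤ)) ∘ₗ
          (MonoidAlgebra.coeffLinearEquiv ℤ).toLinearMap := by
      ext
      simp
    exact (LinearMap.congr_fun h x).trans hx

/-- The underlying abelian group of `I_{K,S}`. -/
abbrev AugKernel : Type _ := (augKernel S).toSubmodule

/-- The Galois representation on `I_{K,S}`. -/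
abbrev augRep : Representation ℤ Gal(K/k) (AugKernel S) := (augKernel S).toRepresentation

/-- The group `𝓞_{K,S}ˣ` of `S`-units of `K`. -/
abbrev unitsOf : Subgroup Kˣ := sUnits (S : Set (Place K))

/-- The Galois action on `S`-units, for a Galois stable set `S` of places. -/
instance : MulDistribMulAction Gal(K/k) (unitsOf S) where
  smul σ u := ⟨σ • (u : Kˣ), by
    intro v hv
    have h := valuation_smul σ (σ⁻¹ • v) ((u : Kˣ) : K)
    rw [smul_inv_smul] at h
    refine h.trans (u.2 _ fun h' => hv ?_)
    have h2 := S.smul_mem σ h'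
    rwa [show σ • (Sum.inr (σ⁻¹ • v) : Place K) = Sum.inr v from
      congrArg Sum.inr (smul_inv_smul σ v)] at h2⟩
  one_smul u := Subtype.ext (one_smul _ (u : Kˣ))
  mul_smul σ τ u := Subtype.ext (mul_smul σ τ (u : Kˣ))
  smul_mul σ u v := Subtype.ext (smul_mul' σ (u : Kˣ) (v : Kˣ))
  smul_one σ := Subtype.ext (smul_one σ)

/-- The Galois representation on `𝓞_{K,S}ˣ` (written additively). -/
abbrev unitRep : Representation ℤ Gal(K/k) (Additive (unitsOf S)) :=
  Representation.ofMulDistribMulAction Gal(K/k) (unitsOf S)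

end Modules

section Invariants

variable {k K : Type*} [Field k] [NumberField k] [Field K] [NumberField K] [Algebra k K]
  (S : SubMulAction Gal(K/k) (Place K)) (H : Subgroup Gal(K/k))

/-- The set `S(K^H)` of places of `K^H` below those in `S`. -/
abbrev fixedPlaces : Set (Place (IntermediateField.fixedField H)) :=
  placesBelow (IntermediateField.fixedField H) (S : Set (Place K))

/-- The group `𝓞_{K^H,S}ˣ`, as a subgroup of `Kˣ`. -/
def fixedUnits : Subgroup Kˣ :=
  (sUnits (fixedPlaces S H)).map
    (Units.map (algebraMap (IntermediateField.fixedField H) K : _ →* K))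

/-- The group `i(I_{K,S})^H`, as a subgroup of `Kˣ`. -/
def fixedImage (i : (augRep S).IntertwiningMap (unitRep S)) : Subgroup Kˣ :=
  (AddMonoidHom.toMultiplicativeLeft i.toLinearMap.toAddMonoidHom).range.map (unitsOf S).subtype ⊓
    FixedPoints.subgroup H Kˣ

variable [Finite S]

/-- `n(H)`, the product of the local degrees in `K/K^H` of the places in `S(K^H)`. -/
def nProd : ℕ := ∏ᶠ p : fixedPlaces S H, localDegree K (p : Place (IntermediateField.fixedField H))

/-- `l(H)`, the least common multiple of the local degrees in `K/K^H` of the places in `S(K^H)`. -/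
def lLcm : ℕ :=
  letI := Fintype.ofFinite (fixedPlaces S H)
  Finset.univ.lcm fun p : fixedPlaces S H => localDegree K (p : Place (IntermediateField.fixedField H))

/-- `w(K^H)`, the number of roots of unity in `K^H`. -/
abbrev wNum : ℕ := Units.torsionOrder (IntermediateField.fixedField H)

/-- `h_S(K^H)`, the `S`-class number of `K^H`. -/
abbrev hNum : ℕ := sClassNumber (fixedPlaces S H)

/-- The decomposition group of a place in `S`. -/
abbrev decompositionGroup {S : SubMulAction Gal(K/k) (Place K)} (P : S) : Subgroup Gal(K/k) :=
  MulAction.stabilizer Gal(K/k) (P : Place K)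

end Invariants

end

end FactorReg

/-! Write `n`, `l`, `h`, `w` for the functions of H in the statement, and `r(H)` for the index of
`i(I_{K,S})^H` in the S-units of `K^H`. Two facts about Brauer relations carry the proof.

A function on subgroups is factorisable exactly when every Brauer relation kills it
(`isFactorisable_iff`). Brauer relations are the integral relations between permutation characters,
equivalently between the multiplicities `⟨χ, ℂ[G/H]⟩`. If all of them kill `f`, the group Y is
obtained by adjoining to X one free generator per irreducible character and imposing the required
factorisations; X still injects, since an element of X that becomes trivial is the value of `f` on a
Brauer relation.

Regulator constants do not depend on the pairing (`regulatorConstant_eq`). Two invariant pairings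
differ by an equivariant automorphism T of `V = Hom(M, ℂ)`, which multiplies the determinant on
`M^H` by `det(T | V^H)`. Now `V^H` is the space of equivariant functions `G/H → V`, and the space of
such functions on a G-set depends only on its rational permutation module, so these factors cancel
over a Brauer relation (`prod_det_restrictFixed`).

Hence convenient pairings may be used. In `ℤ[X]` with orthonormal points, the orbit sums are an
orthogonal basis of the H-invariants, with determinant the inverse product of the stabiliser orders.
For the augmentation kernel, the sum of all points is orthogonal to the kernel, and the invariants
have augmentation image generated by `|H| / l(H)`; the determinant is `(|X| / |H|) · l(H)² / n(H)`
(`latticeDet_ker_aug_fixed`). The factor `|X| / |H|` belongs to the trivial module with pairing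
`|X|xy`. Since the H-orbits on S are the places of `K^H` below S and the stabiliser orders are the
local degrees, this is (1).

For (2), pulling a pairing on the units back along `i` multiplies the determinant at H by `(r(H) /
w(H))²`. With (1), the right side of (b) becomes `C_Θ` of the units times `Q²`, where Q is the value
on Θ of the function in (a). As Q is a positive rational, equality in (b) means `Q = 1`, and the
criterion for factorisability finishes the proof. -/

open NumberField IsDedekindDomain
open scoped Pointwise

namespace FactorReg

/-! ### Characters determine representations. -/

section CharacterTheory

variable {F G V W : Type*} [Field F] [Group G] [AddCommGroup V] [Module F V] [AddCommGroup W]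
  [Module F W]

/-- The character of a permutation representation counts fixed points. -/
theorem character_ofMulAction (F : Type*) [Field F] {G : Type*} [Group G] (X : Type*) [MulAction G X]
    [Finite X] (g : G) :
    (Representation.ofMulAction F G X).character g = Nat.card (MulAction.fixedBy X g) := by
  classical
  have := Fintype.ofFinite X
  let b : Module.Basis X F (MonoidAlgebra F X) := .ofRepr (MonoidAlgebra.coeffLinearEquiv F)
  have hb : ∀ x, b x = MonoidAlgebra.single x 1 := fun x => by
    apply b.repr.injective
    rw [b.repr_self]
    rfl
  rw [Representation.character, LinearMap.trace_eq_matrix_trace F b, Matrix.trace]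
  have h : ∀ x, (LinearMap.toMatrix b b (Representation.ofMulAction F G X g)).diag x =
      if g • x = x then 1 else 0 := by
    intro x
    rw [Matrix.diag_apply, LinearMap.toMatrix_apply, hb, Representation.ofMulAction_single,
      ← hb, b.repr_self, Finsupp.single_apply]
  rw [Finset.sum_congr rfl fun x _ => h x, Finset.sum_boole, Nat.card_eq_fintype_card,
    Fintype.card_subtype]
  rfl

theorem isCompl_toSubmodule {ρ : Representation F G V} {U U' : Subrepresentation ρ}
    (h : IsCompl U U') : IsCompl U.toSubmodule U'.toSubmodule :=
  IsCompl.of_eq (congrArg Subrepresentation.toSubmodule h.inf_eq_bot)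
    (congrArg Subrepresentation.toSubmodule h.sup_eq_top)

theorem character_add_of_isCompl [FiniteDimensional F V] {ρ : Representation F G V}
    {U U' : Subrepresentation ρ} (h : IsCompl U U') :
    ρ.character = U.toRepresentation.character + U'.toRepresentation.character := by
  have h' := isCompl_toSubmodule h
  ext g
  let e := Submodule.prodEquivOfIsCompl _ _ h'
  have : ρ g = e.conj ((U.toRepresentation g).prodMap (U'.toRepresentation g)) := by
    apply LinearMap.ext
    intro v
    obtain ⟨w, rfl⟩ := e.surjective v
    simp [LinearEquiv.conj_apply, e, Subrepresentation.toRepresentation]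
  rw [Representation.character, this, LinearMap.trace_conj', LinearMap.trace_prodMap']
  rfl

variable (ρ : Representation F G V) (σ : Representation F G W)

/-- Over a field of characteristic zero, representations of a finite group with the same character
are isomorphic. -/
theorem nonempty_equiv_of_character_eq [Finite G] [CharZero F] [FiniteDimensional F V]
    [FiniteDimensional F W] (h : ρ.character = σ.character) : Nonempty (ρ.Equiv σ) := by
  classical
  have := Fintype.ofFinite G
  have hG : (Nat.card G : F) ≠ 0 := Nat.cast_ne_zero.mpr Nat.card_pos.ne'
  have := invertibleOfNonzero hG
  have : NeZero (Nat.card G : F) := ⟨hG⟩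
  induction hn : Module.finrank F V using Nat.strong_induction_on generalizing V W with
  | _ n ih =>
  have hdim : Module.finrank F V = Module.finrank F W := by
    have := congrFun h 1
    rw [Representation.char_one, Representation.char_one] at this
    exact_mod_cast this
  rcases Nat.eq_zero_or_pos n with h0 | hpos
  · have h1 : Subsingleton V := Module.finrank_zero_iff.mp (hn.trans h0)
    have h2 : Subsingleton W := Module.finrank_zero_iff.mp (hdim.symm.trans (hn.trans h0))
    exact ⟨.mk (0 : V ≃ₗ[F] W) fun g => Subsingleton.elim _ _⟩
  have hV : Nontrivial V := Module.nontrivial_of_finrank_pos (R := F) (by omega)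
  obtain ⟨f, hf⟩ : ∃ f : ρ.IntertwiningMap σ, f ≠ 0 := by
    -- Without nonzero maps, equality of the characters would force `dim End(V) = 0`, against the
    -- identity of a nonzero V.
    by_contra! hall
    have h1 := Representation.card_inv_mul_sum_char_mul_char_eq_finrank ρ σ
    rw [← h, Representation.card_inv_mul_sum_char_mul_char_eq_finrank ρ ρ] at h1
    have : Subsingleton (ρ.IntertwiningMap σ) := ⟨fun a b => (hall a).trans (hall b).symm⟩
    rw [Module.finrank_zero_of_subsingleton (M := ρ.IntertwiningMap σ), Nat.cast_zero,
      Nat.cast_eq_zero] at h1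
    have : Module.Finite F (ρ.IntertwiningMap ρ) :=
      Module.Finite.equiv (Representation.invariantsEquivIntertwiningMap ρ ρ)
    have h2 := Module.finrank_zero_iff.mp h1
    obtain ⟨v, hv⟩ := exists_ne (0 : V)
    exact hv (DFunLike.congr_fun (Subsingleton.elim (Representation.IntertwiningMap.id ρ) 0) v)
  obtain ⟨U, hU⟩ := exists_isCompl f.ker
  obtain ⟨W', hW'⟩ := exists_isCompl f.range
  have hU' := isCompl_toSubmodule hU
  have hW'' := isCompl_toSubmodule hW'
  have hker : f.ker.toSubmodule = LinearMap.ker f.toLinearMap := rfl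
  have hrange : f.range.toSubmodule = LinearMap.range f.toLinearMap := rfl
  let a : U.toRepresentation.IntertwiningMap f.range.toRepresentation :=
    ⟨(f.toLinearMap.domRestrict U.toSubmodule).codRestrict f.range.toSubmodule
      fun v => ⟨v, rfl⟩, fun g => by
        apply LinearMap.ext
        intro v
        apply Subtype.ext
        exact f.isIntertwining _ _ g v⟩
  have ha : Function.Bijective a := by
    constructor
    · rw [injective_iff_map_eq_zero]
      intro v hv
      have h1 : f v = 0 := congrArg Subtype.val hv
      exact Subtype.ext ((Submodule.disjoint_def.mp hU'.disjoint) v h1 v.2)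
    · rintro ⟨w, v, rfl⟩
      obtain ⟨x, hx, y, hy, rfl⟩ := Submodule.mem_sup.mp
        (hU'.sup_eq_top ▸ Submodule.mem_top : v ∈ f.ker.toSubmodule ⊔ U.toSubmodule)
      refine ⟨⟨y, hy⟩, Subtype.ext ?_⟩
      have h1 : f x = 0 := hx
      change f y = f (x + y)
      rw [map_add, h1, zero_add]
  let ea := a.ofBijective ha
  -- The complement of the kernel is isomorphic to the range, so their characters cancel; the
  -- induction continues with the kernel, which is proper as `f ≠ 0`.
  have hchar : f.ker.toRepresentation.character = W'.toRepresentation.character := by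
    have h1 := character_add_of_isCompl hU
    have h2 := character_add_of_isCompl hW'
    rw [h, h2, Representation.char_iso ea, add_comm] at h1
    exact (add_right_cancel h1).symm
  have hlt : Module.finrank F f.ker.toSubmodule < n := by
    rw [← hn]
    refine Submodule.finrank_lt fun htop => hf ?_
    apply Representation.IntertwiningMap.ext
    exact LinearMap.ker_eq_top.mp (hker.symm.trans htop)
  obtain ⟨ek⟩ := ih _ hlt _ _ hchar rfl
  let eV := Submodule.prodEquivOfIsCompl _ _ hU'
  let eW := Submodule.prodEquivOfIsCompl _ _ hW''.symm
  refine ⟨.mk (eV.symm.trans ((ek.toLinearEquiv.prodCongr ea.toLinearEquiv).trans eW)) fun g => ?_⟩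
  apply LinearMap.ext
  intro v
  obtain ⟨w, rfl⟩ := eV.surjective v
  have h1 : ρ g (eV w) = eV (f.ker.toRepresentation g w.1, U.toRepresentation g w.2) := by
    simp [eV, Subrepresentation.toRepresentation]
  have h2 : ∀ w, σ g (eW w) = eW (W'.toRepresentation g w.1, f.range.toRepresentation g w.2) := by
    intro w
    simp [eW, Subrepresentation.toRepresentation]
  have h3 := ek.toIntertwiningMap.isIntertwining _ _ g w.1
  have h4 := ea.toIntertwiningMap.isIntertwining _ _ g w.2
  simp only [LinearMap.comp_apply, LinearEquiv.coe_coe, LinearEquiv.trans_apply, h1,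
    LinearEquiv.symm_apply_apply, h2, LinearEquiv.prodCongr_apply]
  exact congrArg eW (Prod.ext h3 h4)

/-- A property of characters that is additive and holds for irreducible representations holds for
all representations. -/
theorem sum_character_mul_eq_zero [Finite G] [Fintype G] (δ : G → ℂ)
    (hδ : ∀ χ : Irr G, ∑ g, χ.1 g * δ g = 0) {V : Type*} [AddCommGroup V] [Module ℂ V]
    [FiniteDimensional ℂ V] (ρ : Representation ℂ G V) : ∑ g, ρ.character g * δ g = 0 := by
  classical
  have : NeZero (Nat.card G : ℂ) := ⟨Nat.cast_ne_zero.mpr Nat.card_pos.ne'⟩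
  induction hn : Module.finrank ℂ V using Nat.strong_induction_on generalizing V with
  | _ n ih =>
  rcases subsingleton_or_nontrivial V with hV | hV
  · refine Finset.sum_eq_zero fun g _ => ?_
    rw [Representation.character, Subsingleton.elim (ρ g) 0, map_zero, zero_mul]
  by_cases hirr : ∃ U : Subrepresentation ρ, U ≠ ⊥ ∧ U ≠ ⊤
  · obtain ⟨U, hU0, hU1⟩ := hirr
    obtain ⟨U', hU'⟩ := exists_isCompl U
    have hlt : ∀ U : Subrepresentation ρ, U ≠ ⊤ → Module.finrank ℂ U.toSubmodule < n := by
      intro U hU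
      rw [← hn]
      exact Submodule.finrank_lt fun h => hU (Subrepresentation.toSubmodule_injective h)
    rw [character_add_of_isCompl hU']
    simp only [Pi.add_apply, add_mul, Finset.sum_add_distrib]
    rw [ih _ (hlt U hU1) _ rfl, ih _ (hlt U' ?_) _ rfl, add_zero]
    rintro rfl
    exact hU0 (eq_bot_of_isCompl_top hU')
  · push Not at hirr
    -- `Irr` only admits representations on coordinate spaces, so an irreducible `ρ` is transported
    -- along a basis.
    let b := Module.finBasis ℂ V
    let e : V ≃ₗ[ℂ] (Fin (Module.finrank ℂ V) → ℂ) := b.equivFun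
    let ρ' : Representation ℂ G (Fin (Module.finrank ℂ V) → ℂ) :=
      { toFun := fun g => e.conj (ρ g)
        map_one' := by rw [map_one]; exact LinearEquiv.conj_id e
        map_mul' := fun g h => by rw [map_mul]; exact LinearEquiv.conj_comp e _ _ }
    have hchar : ρ'.character = ρ.character := by
      ext g
      exact LinearMap.trace_conj' (ρ g) e
    have hnt : Nontrivial (Subrepresentation ρ') := by
      refine ⟨⊥, ⊤, fun h => ?_⟩
      have h1 : (⊥ : Submodule ℂ (Fin (Module.finrank ℂ V) → ℂ)) = ⊤ :=
        congrArg Subrepresentation.toSubmodule h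
      have := e.symm.toEquiv.nontrivial
      exact bot_ne_top h1
    have hirr' : ρ'.IsIrreducible :=
      { eq_bot_or_eq_top := fun U => by
          let U0 : Subrepresentation ρ :=
            ⟨U.toSubmodule.comap e.toLinearMap, fun g v hv => by
              have h1 := U.apply_mem_toSubmodule g hv
              simpa [ρ', LinearEquiv.conj_apply] using h1⟩
          have hmap : U.toSubmodule = U0.toSubmodule.map e.toLinearMap := by
            rw [Submodule.map_comap_eq_of_surjective e.surjective]
          by_cases hU0 : U0 = ⊥
          · left
            apply Subrepresentation.toSubmodule_injective
            rw [hmap, hU0]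
            exact Submodule.map_bot _
          · right
            apply Subrepresentation.toSubmodule_injective
            rw [hmap, hirr U0 hU0]
            exact (Submodule.map_top _).trans (LinearMap.range_eq_top.mpr e.surjective) }
    rw [← hchar]
    exact hδ ⟨ρ'.character, _, ρ', hirr', rfl⟩

end CharacterTheory

theorem prod_zpow_eq_zpow_sum {ι X : Type*} [CommGroup X] (s : Finset ι) (a : ι → ℤ) (x : X) :
    ∏ i ∈ s, x ^ a i = x ^ ∑ i ∈ s, a i := by
  classical
  induction s using Finset.induction_on with
  | empty => simp
  | insert i s hi ih => rw [Finset.prod_insert hi, Finset.sum_insert hi, zpow_add, ih]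

/-! ### Brauer relations and the criterion for factorisability. -/

section BrauerRelations

variable {G : Type*} [Group G]

/-- The number of fixed points of `g` on `G ⧸ H`. -/
noncomputable def fixCard (H : Subgroup G) (g : G) : ℕ := Nat.card (MulAction.fixedBy (G ⧸ H) g)

theorem fixCard_inv (H : Subgroup G) (g : G) : fixCard H g⁻¹ = fixCard H g := by
  rw [fixCard, MulAction.fixedBy_inv, fixCard]

variable [Finite G]

theorem permChar_apply (H : Subgroup G) (g : G) : permChar H g = fixCard H g :=
  character_ofMulAction ℂ (G ⧸ H) g

theorem card_fixedBy_sigma [Fintype (Subgroup G)] (n : Subgroup G → ℕ) (g : G) :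
    Nat.card (MulAction.fixedBy (Σ j : (Σ H : Subgroup G, Fin (n H)), G ⧸ j.1) g) =
      ∑ H, n H * fixCard H g := by
  let e : MulAction.fixedBy (Σ j : (Σ H : Subgroup G, Fin (n H)), G ⧸ j.1) g ≃
      Σ j : (Σ H : Subgroup G, Fin (n H)), MulAction.fixedBy (G ⧸ j.1) g :=
    { toFun := fun x => ⟨x.1.1, x.1.2, by
        have h := x.2
        rw [MulAction.mem_fixedBy, Sigma.ext_iff] at h
        exact eq_of_heq h.2⟩
      invFun := fun x => ⟨⟨x.1, x.2.1⟩, by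
        rw [MulAction.mem_fixedBy, Sigma.ext_iff]
        exact ⟨rfl, heq_of_eq x.2.2⟩⟩
      left_inv := fun x => rfl
      right_inv := fun x => rfl }
  rw [Nat.card_congr e, Nat.card_sigma, Fintype.sum_sigma]
  refine Finset.sum_congr rfl fun H _ => ?_
  change ∑ _ : Fin (n H), fixCard H g = _
  simp

/-- Brauer relations are the relations between permutation characters. -/
theorem isBrauerRelation_iff [Fintype (Subgroup G)] (Θ : Subgroup G → ℤ) :
    IsBrauerRelation Θ ↔ ∀ g : G, ∑ H, Θ H * (fixCard H g : ℤ) = 0 := by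
  have key : ∀ g : G, ∑ H, Θ H * (fixCard H g : ℤ) =
      (Nat.card (MulAction.fixedBy (Σ j : (Σ H : Subgroup G, Fin (Θ H).toNat), G ⧸ j.1) g) : ℤ) -
      (Nat.card (MulAction.fixedBy (Σ j : (Σ H : Subgroup G, Fin (-Θ H).toNat), G ⧸ j.1) g) : ℤ) := by
    intro g
    rw [card_fixedBy_sigma, card_fixedBy_sigma]
    push_cast
    rw [← Finset.sum_sub_distrib]
    refine Finset.sum_congr rfl fun H _ => ?_
    rw [← sub_mul]
    congr 1
    omega
  constructor
  · rintro ⟨e⟩ g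
    have h := congrFun (Representation.char_iso e) g
    rw [character_ofMulAction, character_ofMulAction, Nat.cast_inj] at h
    rw [key, h, sub_self]
  · intro h
    apply nonempty_equiv_of_character_eq
    ext g
    rw [character_ofMulAction, character_ofMulAction]
    have h1 := h g
    rw [key, sub_eq_zero] at h1
    exact_mod_cast h1

theorem charInner_permChar [Fintype G] (χ : G → ℂ) (H : Subgroup G) :
    charInner χ (permChar H) = (Nat.card G : ℂ)⁻¹ * ∑ g, χ g * fixCard H g := by
  rw [charInner, finsum_eq_sum_of_fintype]
  congr 1
  refine Finset.sum_congr rfl fun g _ => ?_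
  rw [permChar_apply]
  simp

/-- The inner product is the dimension of a space of intertwining maps from `ℂ[G/H]`. Conjugation
and inversion play no role, because permutation characters are integral and agree on `g` and `g⁻¹`.
-/
theorem exists_charInner_permChar (χ : Irr G) (H : Subgroup G) :
    ∃ m : ℕ, (m : ℂ) = charInner χ.1 (permChar H) := by
  have := Fintype.ofFinite G
  have := invertibleOfNonzero (Nat.cast_ne_zero.mpr Nat.card_pos.ne' : (Nat.card G : ℂ) ≠ 0)
  obtain ⟨χ, n, ρ, hρ, rfl⟩ := χ
  refine ⟨Module.finrank ℂ ((Representation.ofMulAction ℂ G (G ⧸ H)).IntertwiningMap ρ), ?_⟩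
  rw [← Representation.card_inv_mul_sum_char_mul_char_eq_finrank, charInner_permChar]
  congr 1
  refine Finset.sum_congr rfl fun g _ => ?_
  rw [character_ofMulAction]
  exact congrArg _ (congrArg _ (fixCard_inv H g))

/-- Orthogonality makes the irreducible characters linearly independent in the finite-dimensional
space of functions on G. Finiteness turns the `∏ᶠ` over characters into a genuine product. -/
instance finite_irr : Finite (Irr G) := by
  classical
  have := Fintype.ofFinite G
  have := invertibleOfNonzero (Nat.cast_ne_zero.mpr Nat.card_pos.ne' : (Nat.card G : ℂ) ≠ 0)
  have horth : ∀ χ ψ : Irr G, χ ≠ ψ → ∑ g, χ.1 g * ψ.1 g⁻¹ = 0 := by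
    rintro ⟨χ, n, ρ, hρ, rfl⟩ ⟨ψ, m, σ, hσ, rfl⟩ h
    have h1 := Representation.char_orthonormal ρ σ
    rw [if_neg, mul_eq_zero] at h1
    · exact h1.resolve_left (inv_ne_zero (Nat.cast_ne_zero.mpr Nat.card_pos.ne'))
    · rintro ⟨e⟩
      exact h (Subtype.ext (Representation.char_iso e.symm))
  have hnorm : ∀ χ : Irr G, ∑ g, χ.1 g * χ.1 g⁻¹ ≠ 0 := by
    rintro ⟨χ, n, ρ, hρ, rfl⟩ h
    have h1 := Representation.char_orthonormal ρ ρ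
    rw [if_pos ⟨.refl ρ⟩, h, mul_zero] at h1
    exact zero_ne_one h1
  have hli : LinearIndependent ℂ (fun χ : Irr G => χ.1) := by
    rw [linearIndependent_iff']
    intro s c hc ψ hψ
    have h1 : ∑ g, (∑ χ ∈ s, c χ • χ.1) g * ψ.1 g⁻¹ = 0 := by
      rw [hc]
      simp
    simp only [Finset.sum_apply, Pi.smul_apply, smul_eq_mul, Finset.sum_mul, mul_assoc] at h1
    rw [Finset.sum_comm] at h1
    simp only [← Finset.mul_sum] at h1
    rw [Finset.sum_eq_single_of_mem ψ hψ fun χ _ hne => by rw [horth _ _ hne, mul_zero]] at h1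
    exact (mul_eq_zero.mp h1).resolve_right (hnorm ψ)
  exact hli.finite

theorem isBrauerRelation_iff_multiplicity [Fintype (Subgroup G)] {m : Irr G → Subgroup G → ℕ}
    (hm : ∀ (χ : Irr G) (H : Subgroup G), (m χ H : ℂ) = charInner χ.1 (permChar H))
    (Θ : Subgroup G → ℤ) : IsBrauerRelation Θ ↔ ∀ χ, ∑ H, Θ H * (m χ H : ℤ) = 0 := by
  have := Fintype.ofFinite G
  have hG : (Nat.card G : ℂ)⁻¹ ≠ 0 := inv_ne_zero (Nat.cast_ne_zero.mpr Nat.card_pos.ne')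
  rw [isBrauerRelation_iff]
  let δ : G → ℤ := fun g => ∑ H, Θ H * (fixCard H g : ℤ)
  have hδ : ∀ χ : G → ℂ, ∑ g, χ g * (δ g : ℂ) = ∑ H, (Θ H : ℂ) * ∑ g, χ g * fixCard H g := by
    intro χ
    simp only [δ, Int.cast_sum, Finset.mul_sum]
    rw [Finset.sum_comm]
    refine Finset.sum_congr rfl fun H _ => Finset.sum_congr rfl fun g _ => ?_
    push_cast
    ring
  have key : ∀ χ : Irr G, ((∑ H, Θ H * (m χ H : ℤ) : ℤ) : ℂ) =
      (Nat.card G : ℂ)⁻¹ * ∑ g, χ.1 g * (δ g : ℂ) := by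
    intro χ
    rw [hδ]
    push_cast
    rw [Finset.mul_sum]
    refine Finset.sum_congr rfl fun H _ => ?_
    rw [hm, charInner_permChar]
    ring
  constructor
  · intro h χ
    rw [← Int.cast_inj (α := ℂ), key, Int.cast_zero]
    refine mul_eq_zero_of_right _ (Finset.sum_eq_zero fun g _ => ?_)
    rw [show δ g = 0 from h g, Int.cast_zero, mul_zero]
  · intro h
    have h1 : ∀ χ : Irr G, ∑ g, χ.1 g * (δ g : ℂ) = 0 := fun χ =>
      (mul_eq_zero.mp ((key χ).symm.trans (by rw [h χ, Int.cast_zero]))).resolve_left hG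
    have h2 : ∀ H, ∑ g, (fixCard H g : ℂ) * (δ g : ℂ) = 0 := by
      intro H
      have h3 := sum_character_mul_eq_zero _ h1 (Representation.ofMulAction ℂ G (G ⧸ H))
      simp only [character_ofMulAction] at h3
      exact h3
    -- `δ` is itself an integral combination of permutation characters and is orthogonal to all of
    -- them, hence to itself; being integer valued, it vanishes.
    have h3 : ∑ g, δ g * δ g = 0 := by
      have h4 : ∑ g, (δ g : ℂ) * (δ g : ℂ) = 0 := by
        rw [hδ]
        refine Finset.sum_eq_zero fun H _ => ?_
        simp_rw [mul_comm (δ _ : ℂ)]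
        rw [h2, mul_zero]
      exact_mod_cast h4
    intro g
    exact mul_self_eq_zero.mp
      ((Finset.sum_eq_zero_iff_of_nonneg fun g _ => mul_self_nonneg (δ g)).mp h3 g
        (Finset.mem_univ g))

/-- A function is factorisable if and only if it is trivial on Brauer relations. -/
theorem isFactorisable_iff [Fintype (Subgroup G)] {X : Type*} [CommGroup X] (f : Subgroup G → X) :
    IsFactorisable f ↔ ∀ Θ : Subgroup G → ℤ, IsBrauerRelation Θ → ∏ H, f H ^ Θ H = 1 := by
  classical
  have := Fintype.ofFinite (Irr G)
  constructor
  · rintro ⟨m, hm, Y, _, ι, g, hι, hg⟩ Θ hΘ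
    rw [isBrauerRelation_iff_multiplicity hm] at hΘ
    apply hι
    rw [map_one, map_prod]
    have h1 : ∀ H, ι (f H ^ Θ H) = ∏ χ, g χ ^ (Θ H * (m χ H : ℤ)) := by
      intro H
      rw [map_zpow, hg, finprod_eq_prod_of_fintype, ← Finset.prod_zpow]
      refine Finset.prod_congr rfl fun χ _ => ?_
      rw [mul_comm, zpow_mul, zpow_natCast]
    rw [Finset.prod_congr rfl fun H _ => h1 H, Finset.prod_comm]
    refine Finset.prod_eq_one fun χ _ => ?_
    rw [prod_zpow_eq_zpow_sum, hΘ χ, zpow_zero]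
  · intro h
    choose m hm using fun χ : Irr G => exists_charInner_permChar χ
    refine ⟨m, hm, ?_⟩
    -- Generators are indexed by `Fin` so that the quotient lives in the universe of X, as
    -- `IsFactorisable` demands.
    let e := Fintype.equivFin (Irr G)
    -- The range of `r` is the subgroup of relations generated by equating each `f H` with the
    -- corresponding product of the free generators.
    let r : (Subgroup G → ℤ) → X × (Fin (Fintype.card (Irr G)) → Multiplicative ℤ) := fun θ =>
      ((∏ H, f H ^ θ H)⁻¹, fun i => Multiplicative.ofAdd (∑ H, θ H * (m (e.symm i) H : ℤ)))
    have r_add : ∀ θ θ', r (θ + θ') = r θ * r θ' := by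
      intro θ θ'
      refine Prod.ext ?_ (funext fun i => ?_)
      · simp [r, zpow_add, Finset.prod_mul_distrib, mul_comm]
      · simp only [r, Pi.add_apply, add_mul, Finset.sum_add_distrib, ofAdd_add, Prod.snd_mul,
          Pi.mul_apply]
    have r_zero : r 0 = 1 := by
      have h1 := r_add 0 0
      rw [add_zero] at h1
      exact left_eq_mul.mp h1
    let N : Subgroup (X × (Fin (Fintype.card (Irr G)) → Multiplicative ℤ)) :=
      { carrier := Set.range r
        mul_mem' := by rintro _ _ ⟨θ, rfl⟩ ⟨θ', rfl⟩; exact ⟨θ + θ', r_add θ θ'⟩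
        one_mem' := ⟨0, r_zero⟩
        inv_mem' := by
          rintro _ ⟨θ, rfl⟩
          refine ⟨-θ, eq_inv_of_mul_eq_one_left ?_⟩
          rw [← r_add, neg_add_cancel, r_zero] }
    refine ⟨(X × (Fin (Fintype.card (Irr G)) → Multiplicative ℤ)) ⧸ N, inferInstance,
      (QuotientGroup.mk' N).comp (MonoidHom.inl X _),
      fun χ => QuotientGroup.mk' N (1, Pi.mulSingle (e χ) (Multiplicative.ofAdd 1)), ?_, ?_⟩
    · rw [injective_iff_map_eq_one]
      intro x hx
      obtain ⟨θ, hθ⟩ := (QuotientGroup.eq_one_iff _).mp hx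
      -- An element of N lying in X has trivial free part, which says that all multiplicities of `θ`
      -- vanish.
      have h1 : IsBrauerRelation θ := by
        rw [isBrauerRelation_iff_multiplicity hm]
        intro χ
        have h2 := congrFun (congrArg Prod.snd hθ) (e χ)
        simp only [r, e.symm_apply_apply] at h2
        exact ofAdd_eq_one.mp h2
      have h2 := congrArg Prod.fst hθ
      simp only [r, h θ h1, inv_one] at h2
      exact h2.symm
    · intro H
      rw [finprod_eq_prod_of_fintype]
      simp_rw [← map_pow]
      rw [← map_prod]
      -- The formal sum consisting of H alone yields the relation that expresses `f H`.
      refine (QuotientGroup.eq.mpr ⟨Pi.single H 1, ?_⟩)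
      refine Prod.ext ?_ (funext fun i => ?_)
      · simp only [r, Prod.fst_mul, Prod.fst_inv, MonoidHom.inl_apply, Prod.fst_prod, Prod.pow_fst,
          one_pow, Finset.prod_const_one, mul_one, inv_inj]
        rw [Finset.prod_eq_single_of_mem H (Finset.mem_univ H) fun H' _ hne => by
          rw [Pi.single_eq_of_ne hne, zpow_zero], Pi.single_eq_same, zpow_one]
      · simp only [r, Prod.snd_mul, Prod.snd_inv, MonoidHom.inl_apply, Prod.snd_prod, Prod.pow_snd,
          inv_one, one_mul, Finset.prod_apply, Pi.pow_apply]
        rw [Finset.prod_eq_single_of_mem (e.symm i) (Finset.mem_univ _) fun χ _ hne => by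
            rw [Pi.mulSingle_eq_of_ne (fun h => hne (by rw [h, e.symm_apply_apply])), one_pow],
          e.apply_symm_apply, Pi.mulSingle_eq_same,
          Finset.sum_eq_single_of_mem H (Finset.mem_univ H) fun H' _ hne => by
          rw [Pi.single_eq_of_ne hne, zero_mul], Pi.single_eq_same, one_mul, ← ofAdd_nsmul]
        simp

end BrauerRelations

/-! ### Determinants on fixed spaces cancel over Brauer relations. -/

noncomputable section Determinants

/-- The matrix is block triangular for any linear order on the index type, so an arbitrary one is
imposed. -/
theorem det_blockDiagonal_dependent {o R : Type*} [Fintype o] [DecidableEq o] [CommRing R]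
    {n : o → Type*} [∀ i, Fintype (n i)] [∀ i, DecidableEq (n i)] (d : ∀ i, Matrix (n i) (n i) R) :
    (Matrix.blockDiagonal' d).det = ∏ i, (d i).det := by
  let : LinearOrder o := LinearOrder.lift' (Fintype.equivFin o) (Fintype.equivFin o).injective
  rw [(Matrix.blockTriangular_blockDiagonal' d).det_fintype]
  refine Finset.prod_congr rfl fun k _ => ?_
  let e : n k ≃ {a : Σ i, n i // a.1 = k} :=
    { toFun := fun x => ⟨⟨k, x⟩, rfl⟩
      invFun := fun a => a.2 ▸ a.1.2
      left_inv := fun x => rfl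
      right_inv := by rintro ⟨⟨i, x⟩, rfl⟩; rfl }
  rw [← Matrix.det_submatrix_equiv_self e]
  congr 1
  ext i j
  exact Matrix.blockDiagonal'_apply_eq d k i j

theorem det_pi_dependent {ι F : Type*} [Fintype ι] [Field F] {M : ι → Type*}
    [∀ i, AddCommGroup (M i)] [∀ i, Module F (M i)] [∀ i, FiniteDimensional F (M i)]
    (f : ∀ i, M i →ₗ[F] M i) :
    LinearMap.det (LinearMap.pi fun i => f i ∘ₗ LinearMap.proj i) = ∏ i, LinearMap.det (f i) := by
  classical
  let b := fun i => Module.finBasis F (M i)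
  simp_rw [← LinearMap.det_toMatrix (Pi.basis b), ← LinearMap.det_toMatrix (b _)]
  rw [← det_blockDiagonal_dependent]
  congr 1
  ext ⟨i₁, i₂⟩ ⟨j₁, j₂⟩
  rw [LinearMap.toMatrix_apply, Pi.basis_apply, Pi.basis_repr,
    LinearMap.pi_apply, LinearMap.comp_apply, LinearMap.proj_apply]
  by_cases h : i₁ = j₁
  · subst h
    rw [Matrix.blockDiagonal'_apply_eq, LinearMap.toMatrix_apply]
    exact congrArg (fun v => (b i₁).repr (f i₁ v) i₂) (Pi.single_eq_same (M := M) i₁ _)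
  · rw [Matrix.blockDiagonal'_apply_ne _ _ _ h]
    refine (congrArg (fun v => (b i₁).repr (f i₁ v) i₂) (Pi.single_eq_of_ne (M := M) h _)).trans ?_
    rw [map_zero, map_zero, Finsupp.zero_apply]

variable {G F V : Type*} [Group G] [Field F] [AddCommGroup V] [Module F V]

/-- The equivariant functions from a `G`-set to a representation. -/
def equivariantFunctions (ρ : Representation F G V) (X : Type*) [MulAction G X] :
    Submodule F (X → V) where
  carrier := {φ | ∀ g x, φ (g • x) = ρ g (φ x)}
  add_mem' h h' g x := by simp [h g x, h' g x]
  zero_mem' g x := by simp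
  smul_mem' a φ h g x := by simp [h g x]

/-- Equivariant functions on `⨆ G ⧸ H j` are families of `H j`-invariant vectors. -/
def equivariantFunctionsEquiv (ρ : Representation F G V) {J : Type*} (H : J → Subgroup G) :
    equivariantFunctions ρ (Σ j, G ⧸ H j) ≃ₗ[F]
      Π j, Representation.invariants (ρ.comp (H j).subtype) where
  toFun φ j := ⟨φ.1 ⟨j, ((1 : G) : G ⧸ H j)⟩, fun h => by
    have h1 := φ.2 (h : G) ⟨j, ((1 : G) : G ⧸ H j)⟩
    refine h1.symm.trans (congrArg φ.1 ?_)
    change (⟨j, ((h * 1 : G) : G ⧸ H j)⟩ : Σ j, G ⧸ H j) = _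
    congr 1
    exact QuotientGroup.eq.mpr (by simp)⟩
  map_add' φ ψ := rfl
  map_smul' a φ := rfl
  invFun v := ⟨fun x => Quotient.liftOn' x.2 (fun g => ρ g (v x.1)) (by
      intro a b hab
      have h1 := (v x.1).2 ⟨a⁻¹ * b, QuotientGroup.leftRel_apply.mp hab⟩
      change ρ (a⁻¹ * b) (v x.1 : V) = v x.1 at h1
      change ρ a (v x.1 : V) = ρ b (v x.1 : V)
      conv_lhs => rw [← h1]
      rw [← Module.End.mul_apply, ← map_mul, mul_inv_cancel_left]), by
    rintro g ⟨j, x⟩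
    obtain ⟨a, rfl⟩ := QuotientGroup.mk_surjective x
    change ρ (g * a) (v j : V) = ρ g (ρ a (v j : V))
    rw [map_mul, Module.End.mul_apply]⟩
  left_inv φ := by
    apply Subtype.ext
    funext ⟨j, x⟩
    obtain ⟨a, rfl⟩ := QuotientGroup.mk_surjective x
    change ρ a (φ.1 ⟨j, ((1 : G) : G ⧸ H j)⟩) = φ.1 ⟨j, (a : G ⧸ H j)⟩
    rw [← φ.2]
    change φ.1 ⟨j, ((a * 1 : G) : G ⧸ H j)⟩ = _
    rw [mul_one]
  right_inv v := by
    funext j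
    apply Subtype.ext
    change ρ 1 (v j : V) = v j
    rw [map_one, Module.End.one_apply]

/-- Extending functions linearly to permutation modules turns pullback into composition. This is the
functoriality that makes pullbacks along inverse isomorphisms inverse to each other. -/
theorem linearCombination_comp_equiv {X Y : Type*} [Module ℚ V] (ψ : Y → V)
    (e : MonoidAlgebra ℚ X →ₗ[ℚ] MonoidAlgebra ℚ Y) (c : MonoidAlgebra ℚ X) :
    Finsupp.linearCombination ℚ (fun x => Finsupp.linearCombination ℚ ψ
      (e (MonoidAlgebra.single x 1)).coeff) c.coeff =
      Finsupp.linearCombination ℚ ψ (e c).coeff := by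
  let L : MonoidAlgebra ℚ Y →ₗ[ℚ] V :=
    Finsupp.linearCombination ℚ ψ ∘ₗ (MonoidAlgebra.coeffLinearEquiv ℚ).toLinearMap
  have h : Finsupp.linearCombination ℚ (fun x => Finsupp.linearCombination ℚ ψ
      (e (MonoidAlgebra.single x 1)).coeff) ∘ₗ
        (MonoidAlgebra.coeffLinearEquiv ℚ).toLinearMap = L ∘ₗ e := by
    ext x
    simp [L]
  exact LinearMap.congr_fun h c

/-- Pulling back equivariant functions along a map of permutation modules. -/
def equivariantPullback (ρ : Representation F G V) [Module ℚ V] {X Y : Type*} [MulAction G X]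
    [MulAction G Y] (e : (Representation.ofMulAction ℚ G X).IntertwiningMap
      (Representation.ofMulAction ℚ G Y)) :
    equivariantFunctions ρ Y →ₗ[F] equivariantFunctions ρ X where
  toFun φ := ⟨fun x => Finsupp.linearCombination ℚ φ.1 (e (MonoidAlgebra.single x 1)).coeff, by
    intro g x
    beta_reduce
    rw [← Representation.ofMulAction_single g x (1 : ℚ), e.isIntertwining]
    have h : ∀ c : MonoidAlgebra ℚ Y, Finsupp.linearCombination ℚ φ.1
        (Representation.ofMulAction ℚ G Y g c).coeff =
          ρ g (Finsupp.linearCombination ℚ φ.1 c.coeff) := by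
      intro c
      let L : MonoidAlgebra ℚ Y →ₗ[ℚ] V :=
        Finsupp.linearCombination ℚ φ.1 ∘ₗ (MonoidAlgebra.coeffLinearEquiv ℚ).toLinearMap
      have : L ∘ₗ Representation.ofMulAction ℚ G Y g =
          ((ρ g).toAddMonoidHom.toRatLinearMap) ∘ₗ L := by
        ext y
        simpa [L] using φ.2 g y
      exact LinearMap.congr_fun this c
    exact h _⟩
  map_add' φ ψ := by
    apply Subtype.ext
    funext x
    simp [Finsupp.linearCombination_apply, Finsupp.sum, Finset.sum_add_distrib]
  map_smul' a φ := by
    apply Subtype.ext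
    funext x
    simp [Finsupp.linearCombination_apply, Finsupp.sum, Finset.smul_sum, smul_comm a]

theorem equivariantPullback_comp_eq_id (ρ : Representation F G V) [Module ℚ V] {X Y : Type*}
    [MulAction G X] [MulAction G Y]
    (e : (Representation.ofMulAction ℚ G X).Equiv (Representation.ofMulAction ℚ G Y))
    (φ : equivariantFunctions ρ X) :
    equivariantPullback ρ e.toIntertwiningMap
      (equivariantPullback ρ e.symm.toIntertwiningMap φ) = φ := by
  apply Subtype.ext
  funext x
  refine (linearCombination_comp_equiv φ.1 e.symm.toLinearMap _).trans ?_
  have h : e.symm.toLinearMap (e.toIntertwiningMap (MonoidAlgebra.single x 1)) =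
      MonoidAlgebra.single x 1 := e.symm_apply_apply _
  rw [h]
  simp

/-- An isomorphism of permutation modules induces one between spaces of equivariant functions. -/
def equivariantCongr (ρ : Representation F G V) [Module ℚ V] {X Y : Type*} [MulAction G X]
    [MulAction G Y]
    (e : (Representation.ofMulAction ℚ G X).Equiv (Representation.ofMulAction ℚ G Y)) :
    equivariantFunctions ρ Y ≃ₗ[F] equivariantFunctions ρ X :=
  .ofLinearMap (equivariantPullback ρ e.toIntertwiningMap)
    (equivariantPullback ρ e.symm.toIntertwiningMap)
    (LinearMap.ext (equivariantPullback_comp_eq_id ρ e))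
    (LinearMap.ext (equivariantPullback_comp_eq_id ρ e.symm))

/-- The restriction of an equivariant endomorphism to the `H`-invariants. -/
def restrictFixed (ρ : Representation F G V) (T : V →ₗ[F] V) (hT : ∀ g v, T (ρ g v) = ρ g (T v))
    (H : Subgroup G) : Representation.invariants (ρ.comp H.subtype) →ₗ[F]
      Representation.invariants (ρ.comp H.subtype) :=
  T.restrict fun v hv h => (hT h v).symm.trans (congrArg T (hv h))

/-- The endomorphism of equivariant functions induced by an equivariant endomorphism. -/
def mapEquivariantFunctions (ρ : Representation F G V) (T : V →ₗ[F] V)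
    (hT : ∀ g v, T (ρ g v) = ρ g (T v)) (X : Type*) [MulAction G X] :
    equivariantFunctions ρ X →ₗ[F] equivariantFunctions ρ X :=
  (LinearMap.compLeft T X).restrict fun φ hφ g x => by
    simp [hφ g x, hT]

/-- Evaluation at the base points of the `G ⧸ H j` turns the action of T on values into the product
of its restrictions to the fixed spaces. -/
theorem det_mapEquivariantFunctions [FiniteDimensional F V] (ρ : Representation F G V)
    (T : V →ₗ[F] V) (hT : ∀ g v, T (ρ g v) = ρ g (T v)) {J : Type*} [Fintype J]
    (H : J → Subgroup G) :
    LinearMap.det (mapEquivariantFunctions ρ T hT (Σ j, G ⧸ H j)) =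
      ∏ j, LinearMap.det (restrictFixed ρ T hT (H j)) := by
  rw [← det_pi_dependent, ← LinearMap.det_conj _ (equivariantFunctionsEquiv ρ H)]
  congr 1
  apply LinearMap.ext
  intro v
  obtain ⟨φ, rfl⟩ := (equivariantFunctionsEquiv ρ H).surjective v
  simp only [LinearMap.comp_apply, LinearEquiv.coe_coe, LinearEquiv.symm_apply_apply]
  rfl

/-- Determinants on fixed spaces of an equivariant automorphism satisfy all Brauer relations. -/
theorem prod_det_restrictFixed [Finite G] [Fintype (Subgroup G)] [FiniteDimensional F V] [CharZero F]
    (ρ : Representation F G V) (T : V →ₗ[F] V) (hT : ∀ g v, T (ρ g v) = ρ g (T v))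
    (hinj : Function.Injective T) {Θ : Subgroup G → ℤ} (hΘ : IsBrauerRelation Θ) :
    ∏ H, LinearMap.det (restrictFixed ρ T hT H) ^ Θ H = 1 := by
  obtain ⟨e⟩ := hΘ
  let : Module ℚ V := Module.compHom V (algebraMap ℚ F)
  have hne : ∀ H, LinearMap.det (restrictFixed ρ T hT H) ≠ 0 := by
    intro H h0
    have h1 : LinearMap.ker (restrictFixed ρ T hT H) = ⊥ :=
      LinearMap.ker_eq_bot.mpr fun v w h => Subtype.ext (hinj (congrArg Subtype.val h))
    exact (LinearMap.bot_lt_ker_of_det_eq_zero h0).ne' h1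
  have h1 := det_mapEquivariantFunctions ρ T hT
    (fun j : (Σ H : Subgroup G, Fin (Θ H).toNat) => j.1)
  have h2 := det_mapEquivariantFunctions ρ T hT
    (fun j : (Σ H : Subgroup G, Fin (-Θ H).toNat) => j.1)
  have h3 := LinearMap.det_conj
    (mapEquivariantFunctions ρ T hT (Σ j : (Σ H : Subgroup G, Fin (-Θ H).toNat), G ⧸ j.1))
    (equivariantCongr ρ e)
  -- T acts on values and the pullback on arguments, with rational coefficients; hence they commute.
  have h4 : (equivariantCongr ρ e).toLinearMap ∘ₗ
      mapEquivariantFunctions ρ T hT (Σ j : (Σ H : Subgroup G, Fin (-Θ H).toNat), G ⧸ j.1) ∘ₗ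
        (equivariantCongr ρ e).symm.toLinearMap =
      mapEquivariantFunctions ρ T hT (Σ j : (Σ H : Subgroup G, Fin (Θ H).toNat), G ⧸ j.1) := by
    apply LinearMap.ext
    intro v
    obtain ⟨φ, rfl⟩ := (equivariantCongr ρ e).surjective v
    simp only [LinearMap.comp_apply, LinearEquiv.coe_coe, LinearEquiv.symm_apply_apply]
    apply Subtype.ext
    funext x
    change Finsupp.linearCombination ℚ (T ∘ φ.1) _ = T (Finsupp.linearCombination ℚ φ.1 _)
    exact (Finsupp.apply_linearCombination ℚ T.toAddMonoidHom.toRatLinearMap φ.1 _).symm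
  have h6 : ∀ n : Subgroup G → ℕ, ∏ j : (Σ H : Subgroup G, Fin (n H)),
      LinearMap.det (restrictFixed ρ T hT j.1) =
        ∏ H, LinearMap.det (restrictFixed ρ T hT H) ^ n H := by
    intro n
    rw [Fintype.prod_sigma]
    refine Finset.prod_congr rfl fun H _ => ?_
    change ∏ _ : Fin (n H), LinearMap.det (restrictFixed ρ T hT H) = _
    simp
  rw [h4, h1, h2, h6, h6] at h3
  -- The positive and negative parts of `Θ` are the two sides of the isomorphism `e`.
  have h5 : ∀ H, LinearMap.det (restrictFixed ρ T hT H) ^ Θ H =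
      LinearMap.det (restrictFixed ρ T hT H) ^ (Θ H).toNat /
        LinearMap.det (restrictFixed ρ T hT H) ^ (-Θ H).toNat := by
    intro H
    rw [← zpow_natCast, ← zpow_natCast, ← zpow_sub₀ (hne H)]
    congr 1
    omega
  rw [Finset.prod_congr rfl fun H _ => h5 H, Finset.prod_div_distrib, div_eq_one_iff_eq]
  · exact h3
  · exact Finset.prod_ne_zero_iff.mpr fun H _ => pow_ne_zero _ (hne H)

end Determinants

/-! ### Lattice determinants and independence of the pairing. -/

noncomputable section Lattices

variable {N : Type*} [AddCommGroup N]

theorem map_eq_of_mkQ_torsion_eq {E : Type*} [AddCommGroup E] [Module.IsTorsionFree ℤ E]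
    (φ : N →ₗ[ℤ] E) {x y : N}
    (h : (Submodule.torsion ℤ N).mkQ x = (Submodule.torsion ℤ N).mkQ y) : φ x = φ y := by
  have h1 : x - y ∈ Submodule.torsion ℤ N := (Submodule.Quotient.eq _).mp h
  obtain ⟨n, hn⟩ := (Submodule.mem_torsion_iff _).mp h1
  have h2 : (n : ℤ) • φ (x - y) = 0 := by
    rw [← map_smul]
    exact (congrArg φ hn).trans (map_zero φ)
  have h3 := (smul_eq_zero.mp h2).resolve_left (nonZeroDivisors.ne_zero n.2)
  rwa [map_sub, sub_eq_zero] at h3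

/-- P need not be invertible: the formula serves both for changes of basis, where `det P = ±1`, and
for sublattices, where `|det P|` is an index. -/
theorem det_gram_of_coordinates {ι : Type*} [Fintype ι] [DecidableEq ι] (B : N →ₗ[ℤ] N →ₗ[ℤ] ℂ)
    (x y : ι → N) (P : Matrix ι ι ℤ)
    (h : ∀ i, (Submodule.torsion ℤ N).mkQ (x i) = ∑ k, P i k • (Submodule.torsion ℤ N).mkQ (y k)) :
    Matrix.det (Matrix.of fun i j => B (x i) (x j)) =
      (P.det : ℂ) ^ 2 * Matrix.det (Matrix.of fun i j => B (y i) (y j)) := by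
  have h' : ∀ i, (Submodule.torsion ℤ N).mkQ (x i) =
      (Submodule.torsion ℤ N).mkQ (∑ k, P i k • y k) := by
    intro i
    rw [h, map_sum]
    exact Finset.sum_congr rfl fun k _ => (map_zsmul _ _ _).symm
  have hB : Matrix.of (fun i j => B (x i) (x j)) =
      P.map (Int.cast : ℤ → ℂ) * Matrix.of (fun i j => B (y i) (y j)) *
        (P.map (Int.cast : ℤ → ℂ)).transpose := by
    ext i j
    have h1 : B (x i) (x j) = B (∑ k, P i k • y k) (∑ k, P j k • y k) :=
      (map_eq_of_mkQ_torsion_eq (B.flip (x j)) (h' i) (E := ℂ)).trans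
        (map_eq_of_mkQ_torsion_eq (B (∑ k, P i k • y k)) (h' j) (E := ℂ))
    rw [Matrix.of_apply, h1]
    simp only [map_sum, LinearMap.sum_apply, map_zsmul, LinearMap.smul_apply, Matrix.mul_apply,
      Matrix.map_apply, Matrix.transpose_apply, Matrix.of_apply, zsmul_eq_mul, Finset.sum_mul]
    refine Finset.sum_congr rfl fun k _ => ?_
    rw [Finset.mul_sum]
    refine Finset.sum_congr rfl fun l _ => ?_
    ring
  rw [hB, Matrix.det_mul, Matrix.det_mul, Matrix.det_transpose]
  have h1 : (P.map (Int.cast : ℤ → ℂ)).det = (P.det : ℂ) := (Int.cast_det P).symm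
  rw [h1]
  ring

theorem mkQ_out (q : N ⧸ Submodule.torsion ℤ N) : (Submodule.torsion ℤ N).mkQ q.out = q :=
  Quotient.out_eq' q

variable [Module.Finite ℤ N]

/-- The lattice determinant can be computed with any basis of `N/tors` and any lifts. -/
theorem latticeDet_eq_det {ι : Type*} [Fintype ι] [DecidableEq ι] (B : N →ₗ[ℤ] N →ₗ[ℤ] ℂ)
    (b : Module.Basis ι ℤ (N ⧸ Submodule.torsion ℤ N)) (x : ι → N)
    (hx : ∀ i, (Submodule.torsion ℤ N).mkQ (x i) = b i) :
    latticeDet N B = Matrix.det (Matrix.of fun i j => B (x i) (x j)) := by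
  let b₀ := Module.finBasis ℤ (N ⧸ Submodule.torsion ℤ N)
  let e := b₀.indexEquiv b
  let b' := b.reindex e.symm
  have h1 := det_gram_of_coordinates B (fun i => (b₀ i).out) (fun i => x (e i))
    (b'.toMatrix b₀).transpose (by
      intro i
      rw [mkQ_out]
      refine (b'.sum_toMatrix_smul_self b₀ i).symm.trans (Finset.sum_congr rfl fun k _ => ?_)
      rw [hx, Matrix.transpose_apply]
      congr 1
      exact b.reindex_apply e.symm k)
  have h2 : IsUnit (b'.toMatrix b₀).transpose.det := by
    rw [Matrix.det_transpose]
    exact b'.isUnit_det b₀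
  have h3 : ((b'.toMatrix b₀).transpose.det : ℂ) ^ 2 = 1 := by
    rcases Int.isUnit_iff.mp h2 with h | h <;> rw [h] <;> norm_num
  rw [h3, one_mul] at h1
  refine h1.trans ?_
  rw [← Matrix.det_submatrix_equiv_self e (Matrix.of fun i j => B (x i) (x j))]
  rfl

theorem latticeDet_eq_det_of_basis {ι : Type*} [Fintype ι] [DecidableEq ι]
    (B : N →ₗ[ℤ] N →ₗ[ℤ] ℂ) (b : Module.Basis ι ℤ N) :
    latticeDet N B = Matrix.det (Matrix.of fun i j => B (b i) (b j)) := by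
  have : Module.IsTorsionFree ℤ N := b.isTorsionFree
  have h : Submodule.torsion ℤ N = ⊥ := Submodule.isTorsionFree_iff_torsion_eq_bot.mp this
  refine latticeDet_eq_det B (b.map (Submodule.quotEquivOfEqBot _ h).symm) b fun i => ?_
  rfl

/-- The functionals on a lattice are determined by their values on a basis. -/
def evalEquiv (N : Type*) [AddCommGroup N] [Module.Finite ℤ N] :
    (N →ₗ[ℤ] ℂ) ≃ₗ[ℂ] (Fin (Module.finrank ℤ (N ⧸ Submodule.torsion ℤ N)) → ℂ) :=
  .ofBijective
    { toFun := fun φ i => φ (Module.finBasis ℤ (N ⧸ Submodule.torsion ℤ N) i).out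
      map_add' := fun φ ψ => rfl
      map_smul' := fun a φ => rfl }
    (by
      let b := Module.finBasis ℤ (N ⧸ Submodule.torsion ℤ N)
      constructor
      · rw [injective_iff_map_eq_zero]
        intro φ hφ
        have h1 : ∀ i, φ (b i).out = 0 := fun i => congrFun hφ i
        apply LinearMap.ext
        intro x
        have h2 : (Submodule.torsion ℤ N).mkQ x = (Submodule.torsion ℤ N).mkQ
            (∑ i, b.repr ((Submodule.torsion ℤ N).mkQ x) i • (b i).out) := by
          rw [map_sum]
          refine (b.sum_repr _).symm.trans (Finset.sum_congr rfl fun i _ => ?_)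
          rw [map_zsmul, mkQ_out]
        rw [map_eq_of_mkQ_torsion_eq φ h2 (E := ℂ), map_sum]
        refine Finset.sum_eq_zero fun i _ => ?_
        rw [map_zsmul, h1, smul_zero]
      · intro c
        refine ⟨b.constr ℤ c ∘ₗ (Submodule.torsion ℤ N).mkQ, funext fun i => ?_⟩
        change b.constr ℤ c ((Submodule.torsion ℤ N).mkQ (b i).out) = c i
        rw [mkQ_out, Module.Basis.constr_basis])

instance : FiniteDimensional ℂ (N →ₗ[ℤ] ℂ) := Module.Finite.equiv (evalEquiv N).symm

variable {G M : Type*} [Group G] [AddCommGroup M] (ρ : Representation ℤ G M)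

/-- The dual complex representation of a lattice. -/
def dualRep : Representation ℂ G (M →ₗ[ℤ] ℂ) where
  toFun g :=
    { toFun := fun φ => φ ∘ₗ ρ g⁻¹
      map_add' := fun φ ψ => rfl
      map_smul' := fun a φ => rfl }
  map_one' := by
    apply LinearMap.ext
    intro φ
    apply LinearMap.ext
    intro x
    simp
  map_mul' g h := by
    apply LinearMap.ext
    intro φ
    apply LinearMap.ext
    intro x
    simp

theorem dualRep_apply (g : G) (φ : M →ₗ[ℤ] ℂ) (x : M) : dualRep ρ g φ x = φ (ρ g⁻¹ x) := rfl

/-- Invariant functionals are functionals on the invariants. -/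
def dualFixedEquiv [Finite G] (H : Subgroup G) :
    Representation.invariants ((dualRep ρ).comp H.subtype) ≃ₗ[ℂ] (fixedBy ρ H →ₗ[ℤ] ℂ) :=
  .ofBijective
    { toFun := fun φ => φ.1.domRestrict (fixedBy ρ H)
      map_add' := fun φ ψ => rfl
      map_smul' := fun a φ => rfl }
    (by
      have := Fintype.ofFinite H
      have hH : (Fintype.card H : ℂ) ≠ 0 := Nat.cast_ne_zero.mpr Fintype.card_ne_zero
      -- The norm map; the inverse of restriction sends `ψ` to `|H|⁻¹ ψ ∘ nm`.
      let nm : M →ₗ[ℤ] fixedBy ρ H :=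
        (∑ h : H, ρ h).codRestrict _ fun x h => by
          simp only [LinearMap.sum_apply, map_sum]
          refine Fintype.sum_equiv (Equiv.mulLeft h) _ _ fun a => ?_
          simp
      have hnm : ∀ x, (nm x : M) = ∑ h : H, ρ h x := fun x =>
        LinearMap.sum_apply _ _ _
      constructor
      · rw [injective_iff_map_eq_zero]
        intro φ hφ
        apply Subtype.ext
        apply LinearMap.ext
        intro x
        have h1 : φ.1 (nm x) = 0 := LinearMap.congr_fun hφ (nm x)
        have h2 : ∀ h : H, φ.1 (ρ h x) = φ.1 x := by
          intro h
          have h3 := LinearMap.congr_fun (φ.2 h⁻¹) x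
          change φ.1 (ρ (((h⁻¹ : H) : G))⁻¹ x) = φ.1 x at h3
          rwa [InvMemClass.coe_inv, inv_inv] at h3
        rw [hnm, map_sum, Finset.sum_congr rfl fun h _ => h2 h, Finset.sum_const,
          Finset.card_univ, nsmul_eq_mul] at h1
        exact (mul_eq_zero.mp h1).resolve_left hH
      · intro ψ
        refine ⟨⟨(Fintype.card H : ℂ)⁻¹ • (ψ ∘ₗ nm), fun h => ?_⟩, ?_⟩
        · apply LinearMap.ext
          intro x
          change (Fintype.card H : ℂ)⁻¹ • ψ (nm (ρ (h : G)⁻¹ x)) = (Fintype.card H : ℂ)⁻¹ • ψ (nm x)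
          congr 2
          apply Subtype.ext
          rw [hnm, hnm]
          refine Fintype.sum_equiv (Equiv.mulRight h⁻¹) _ _ fun a => ?_
          simp
        · apply LinearMap.ext
          intro x
          change (Fintype.card H : ℂ)⁻¹ • ψ (nm x) = ψ x
          have h1 : nm x = Fintype.card H • x := by
            apply Subtype.ext
            rw [hnm]
            have h2 : ∀ h : H, ρ h (x : M) = x := fun h => x.2 h
            rw [Finset.sum_congr rfl fun h _ => h2 h]
            simp
          rw [h1, map_nsmul, nsmul_eq_mul, smul_eq_mul, inv_mul_cancel_left₀ hH])

variable {ρ} [Module.Finite ℤ M]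

/-- Two invariant pairings differ by an equivariant automorphism of the dual. -/
theorem exists_comparison {B₁ B₂ : M →ₗ[ℤ] M →ₗ[ℤ] ℂ} (h₁ : IsInvariantPairing ρ B₁)
    (h₂ : IsInvariantPairing ρ B₂) : ∃ T : (M →ₗ[ℤ] ℂ) →ₗ[ℂ] (M →ₗ[ℤ] ℂ),
      Function.Injective T ∧ (∀ x, T (B₁ x) = B₂ x) ∧
        ∀ g φ, T (dualRep ρ g φ) = dualRep ρ g (T φ) := by
  let b := Module.finBasis ℤ (M ⧸ Submodule.torsion ℤ M)
  let n := Module.finrank ℤ (M ⧸ Submodule.torsion ℤ M)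
  -- `L B` is the complex linear extension of `x ↦ B x` to coordinates. Non-degeneracy makes it
  -- bijective, so T can be taken as `L B₂` after the inverse of `L B₁`.
  let L : (M →ₗ[ℤ] M →ₗ[ℤ] ℂ) → (Fin n → ℂ) →ₗ[ℂ] (M →ₗ[ℤ] ℂ) := fun B =>
    Fintype.linearCombination ℂ fun i => B (b i).out
  have hL : ∀ B, latticeDet M B ≠ 0 → Function.Bijective (L B) := by
    intro B hB
    have h1 : LinearMap.toMatrix' ((evalEquiv M).toLinearMap ∘ₗ L B) =
        (Matrix.of fun i j => B (b i).out (b j).out).transpose := by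
      ext i j
      rw [LinearMap.toMatrix'_apply, LinearMap.comp_apply, Matrix.transpose_apply, Matrix.of_apply]
      have h2 : L B (Pi.single j 1) = B (b j).out := by
        simp [L]
      rw [h2]
      rfl
    have h2 : LinearMap.det ((evalEquiv M).toLinearMap ∘ₗ L B) ≠ 0 := by
      rw [← LinearMap.det_toMatrix', h1, Matrix.det_transpose]
      exact hB
    have h3 := (LinearMap.equivOfDetNeZero _ h2).bijective
    exact (Function.Bijective.of_comp_iff' (evalEquiv M).bijective (L B)).mp h3
  let e₁ := LinearEquiv.ofBijective (L B₁) (hL B₁ h₁.2)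
  have hT : ∀ x, (L B₂ ∘ₗ e₁.symm.toLinearMap) (B₁ x) = B₂ x := by
    have hx : ∀ (B : M →ₗ[ℤ] M →ₗ[ℤ] ℂ) x, B x =
        L B (fun i => (b.repr ((Submodule.torsion ℤ M).mkQ x) i : ℂ)) := by
      intro B x
      have h2 : (Submodule.torsion ℤ M).mkQ x = (Submodule.torsion ℤ M).mkQ
          (∑ i, b.repr ((Submodule.torsion ℤ M).mkQ x) i • (b i).out) := by
        rw [map_sum]
        refine (b.sum_repr _).symm.trans (Finset.sum_congr rfl fun i _ => ?_)
        rw [map_zsmul, mkQ_out]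
      apply LinearMap.ext
      intro y
      have h3 := map_eq_of_mkQ_torsion_eq (B.flip y) h2 (E := ℂ)
      rw [LinearMap.flip_apply, LinearMap.flip_apply] at h3
      rw [h3]
      simp [L, Fintype.linearCombination_apply]
      rfl
    intro x
    have h3 : e₁.symm (B₁ x) = fun i => (b.repr ((Submodule.torsion ℤ M).mkQ x) i : ℂ) := by
      rw [LinearEquiv.symm_apply_eq]
      exact hx B₁ x
    rw [LinearMap.comp_apply, LinearEquiv.coe_coe, h3, ← hx]
  refine ⟨L B₂ ∘ₗ e₁.symm.toLinearMap, (hL B₂ h₂.2).1.comp e₁.symm.injective, hT, ?_⟩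
  -- Invariance of a pairing means that `x ↦ B x` is equivariant. Equivariance of T follows, because
  -- the functionals `B₁ x` span the dual.
  have heq : ∀ B, IsInvariantPairing ρ B → ∀ g x, dualRep ρ g (B x) = B (ρ g x) := by
    intro B hB g x
    apply LinearMap.ext
    intro y
    rw [dualRep_apply, ← hB.1 g]
    simp
  intro g φ
  obtain ⟨c, rfl⟩ := e₁.surjective φ
  have h4 : e₁ c = ∑ i, c i • B₁ (b i).out := Fintype.linearCombination_apply ..
  rw [h4]
  simp only [map_sum, map_smul, heq B₁ h₁, hT, heq B₂ h₂]

variable [Finite G]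

/-- Invariant functionals on M are the functionals on `M^H`, so the Gram matrix on `M^H` is
multiplied by the transposed matrix of T on them. The scalar `c`, later `|H|⁻¹`, enters both sides
alike. -/
theorem latticeDet_comparison {B₁ B₂ : M →ₗ[ℤ] M →ₗ[ℤ] ℂ} (h₁ : IsInvariantPairing ρ B₁)
    {T : (M →ₗ[ℤ] ℂ) →ₗ[ℂ] (M →ₗ[ℤ] ℂ)} (hT : ∀ x, T (B₁ x) = B₂ x)
    (hTG : ∀ g φ, T (dualRep ρ g φ) = dualRep ρ g (T φ)) (H : Subgroup G) (c : ℂ) :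
    latticeDet (fixedBy ρ H) (c • B₂.domRestrict₁₂ (fixedBy ρ H) (fixedBy ρ H)) =
      latticeDet (fixedBy ρ H) (c • B₁.domRestrict₁₂ (fixedBy ρ H) (fixedBy ρ H)) *
        LinearMap.det (restrictFixed (dualRep ρ) T hTG H) := by
  let b := Module.finBasis ℤ (fixedBy ρ H ⧸ Submodule.torsion ℤ (fixedBy ρ H))
  let E := (dualFixedEquiv ρ H).trans (evalEquiv (fixedBy ρ H))
  let TH := restrictFixed (dualRep ρ) T hTG H
  have hmem : ∀ x ∈ fixedBy ρ H, c • B₁ x ∈ Representation.invariants ((dualRep ρ).comp H.subtype) := by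
    intro x hx
    refine Submodule.smul_mem _ _ fun h => ?_
    apply LinearMap.ext
    intro y
    change B₁ x (ρ (h : G)⁻¹ y) = B₁ x y
    rw [← h₁.1 (h : G)]
    have h2 : ρ (h : G) x = x := hx h
    rw [h2]
    simp
  let M' := LinearMap.toMatrix' (E.toLinearMap ∘ₗ TH ∘ₗ E.symm.toLinearMap)
  have hdet : M'.det = LinearMap.det TH := by
    rw [LinearMap.det_toMatrix', LinearMap.det_conj]
  have hmat : Matrix.of (fun i j => (c • B₂.domRestrict₁₂ (fixedBy ρ H) (fixedBy ρ H))
      (b i).out (b j).out) =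
      Matrix.of (fun i j => (c • B₁.domRestrict₁₂ (fixedBy ρ H) (fixedBy ρ H))
        (b i).out (b j).out) * M'.transpose := by
    ext i j
    let v : Representation.invariants ((dualRep ρ).comp H.subtype) := ⟨_, hmem (b i).out (b i).out.2⟩
    have h1 : ∀ k, E v k = (c • B₁.domRestrict₁₂ (fixedBy ρ H) (fixedBy ρ H))
        (b i).out (b k).out := fun k => rfl
    have h2 : E (TH v) j = (c • B₂.domRestrict₁₂ (fixedBy ρ H) (fixedBy ρ H))
        (b i).out (b j).out := by
      change T (c • B₁ ((b i).out : fixedBy ρ H)) ((b j).out : fixedBy ρ H) = _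
      rw [map_smul, hT]
      rfl
    have h3 : E (TH v) = M'.mulVec (E v) := by
      rw [← Matrix.toLin'_apply, Matrix.toLin'_toMatrix']
      simp
    rw [Matrix.of_apply, ← h2, h3, Matrix.mul_apply, Matrix.mulVec, dotProduct]
    refine Finset.sum_congr rfl fun k _ => ?_
    rw [Matrix.of_apply, Matrix.transpose_apply, h1, mul_comm]
  rw [latticeDet, latticeDet]
  change Matrix.det (Matrix.of fun i j => (c • B₂.domRestrict₁₂ (fixedBy ρ H) (fixedBy ρ H))
      (b i).out (b j).out) = _
  rw [hmat, Matrix.det_mul, Matrix.det_transpose, hdet]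

/-- The regulator constant can be computed with any invariant pairing. -/
theorem regulatorConstant_eq [Fintype (Subgroup G)] {Θ : Subgroup G → ℤ} (hΘ : IsBrauerRelation Θ)
    {B : M →ₗ[ℤ] M →ₗ[ℤ] ℂ} (hB : IsInvariantPairing ρ B) :
    regulatorConstant ρ Θ = ∏ H : Subgroup G, latticeDet (fixedBy ρ H)
      ((Nat.card H : ℂ)⁻¹ • B.domRestrict₁₂ (fixedBy ρ H) (fixedBy ρ H)) ^ Θ H := by
  obtain ⟨T, hinj, hT, hTG⟩ := exists_comparison hB (exists_isInvariantPairing ρ).choose_spec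
  rw [regulatorConstant, regulatorProduct, finprod_eq_prod_of_fintype]
  simp_rw [latticeDet_comparison hB hT hTG, mul_zpow]
  rw [Finset.prod_mul_distrib, prod_det_restrictFixed _ T hTG hinj hΘ, mul_one]

end Lattices

/-! ### Permutation lattices, their invariants and orbit sums. -/

noncomputable section PermutationLattices

theorem latticeDet_congr {N N' : Type*} [AddCommGroup N] [AddCommGroup N'] [Module.Finite ℤ N]
    [Module.Finite ℤ N'] [Module.Free ℤ N] (e : N ≃ₗ[ℤ] N') {B : N →ₗ[ℤ] N →ₗ[ℤ] ℂ}
    {B' : N' →ₗ[ℤ] N' →ₗ[ℤ] ℂ} (h : ∀ x y, B x y = B' (e x) (e y)) :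
    latticeDet N B = latticeDet N' B' := by
  let b := Module.finBasis ℤ N
  rw [latticeDet_eq_det_of_basis B b, latticeDet_eq_det_of_basis B' (b.map e)]
  simp only [h, Module.Basis.map_apply]

/-- The determinant of the kernel of a functional `ε` on a lattice, in the presence of a vector
orthogonal to the kernel. -/
theorem latticeDet_ker {L : Type*} [AddCommGroup L] [Module.Finite ℤ L] [Module.Free ℤ L]
    (B : L →ₗ[ℤ] L →ₗ[ℤ] ℂ) (ε : L →ₗ[ℤ] ℤ) {a q : ℤ} (ha : a ≠ 0)
    (hε : LinearMap.range ε = Ideal.span {a}) {σ : L} (hσ : ε σ = q * a)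
    (hl : ∀ x, ε x = 0 → B x σ = 0) :
    B σ σ * latticeDet (LinearMap.ker ε)
      (B.domRestrict₁₂ (LinearMap.ker ε) (LinearMap.ker ε)) = (q : ℂ) ^ 2 * latticeDet L B := by
  let b := Module.finBasis ℤ (LinearMap.ker ε)
  obtain ⟨z, hz⟩ : a ∈ LinearMap.range ε := hε ▸ Ideal.mem_span_singleton_self a
  have hli : ∀ (c : ℤ), ∀ x ∈ LinearMap.ker ε, c • z + x = 0 → c = 0 := by
    intro c x hx h
    have h1 := congrArg ε h
    rw [map_add, map_smul, hz, LinearMap.mem_ker.mp hx, add_zero, map_zero, smul_eq_mul] at h1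
    exact (mul_eq_zero.mp h1).resolve_right ha
  have hsp : ∀ y : L, ∃ c : ℤ, y + c • z ∈ LinearMap.ker ε := by
    intro y
    have h1 : ε y ∈ Ideal.span {a} := hε ▸ LinearMap.mem_range_self ε y
    obtain ⟨c, hc⟩ := Ideal.mem_span_singleton'.mp h1
    refine ⟨-c, ?_⟩
    rw [LinearMap.mem_ker, map_add, map_smul, hz, ← hc, smul_eq_mul]
    ring
  -- A vector `z` of augmentation `a` completes a basis of the kernel. Replacing `z` by `σ` gives a
  -- family with transition determinant `q`, since `ε σ = q ε z`.
  let y := Module.Basis.mkFinCons z b hli hsp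
  have hy0 : y 0 = z := by simp [y]
  have hys : ∀ i, y (Fin.succ i) = b i := fun i => by simp [y]
  let x : Fin (Module.finrank ℤ (LinearMap.ker ε) + 1) → L := Fin.cons σ fun i => (b i : L)
  let P : Matrix (Fin (Module.finrank ℤ (LinearMap.ker ε) + 1))
    (Fin (Module.finrank ℤ (LinearMap.ker ε) + 1)) ℤ := Matrix.of fun i k => y.repr (x i) k
  have hPs : ∀ i k, P (Fin.succ i) k = if Fin.succ i = k then 1 else 0 := by
    intro i k
    simp only [P, Matrix.of_apply, x, Fin.cons_succ]
    rw [← hys, y.repr_self, Finsupp.single_apply]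
  have hP0 : P 0 0 = q := by
    have h1 := congrArg ε (y.sum_repr σ)
    rw [map_sum, Fin.sum_univ_succ, Finset.sum_eq_zero, add_zero, map_smul, hy0, hz, hσ,
      smul_eq_mul] at h1
    · exact mul_right_cancel₀ ha h1
    · intro i _
      rw [map_smul, hys, LinearMap.mem_ker.mp (b i).2, smul_zero]
  have hdetP : P.det = q := by
    rw [Matrix.det_succ_column_zero, Fin.sum_univ_succ, Finset.sum_eq_zero, add_zero, hP0]
    · have h1 : P.submatrix (Fin.succAbove 0) Fin.succ = 1 := by
        ext i j
        rw [Matrix.submatrix_apply, Fin.zero_succAbove, hPs, Matrix.one_apply]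
        simp
      rw [h1]
      simp
    · intro i _
      rw [hPs, if_neg (Fin.succ_ne_zero i)]
      simp
  have hgram := det_gram_of_coordinates B x y P fun i => by
    conv_lhs => rw [← y.sum_repr (x i), map_sum]
    simp only [P, Matrix.of_apply, map_zsmul]
  rw [hdetP, ← latticeDet_eq_det_of_basis B y] at hgram
  -- As `σ` is orthogonal to the kernel, the first column of the Gram matrix has only the entry `B σ
  -- σ`.
  rw [← hgram, latticeDet_eq_det_of_basis _ b, Matrix.det_succ_column_zero, Fin.sum_univ_succ,
    Finset.sum_eq_zero, add_zero]
  · simp only [Fin.val_zero, pow_zero, one_mul]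
    rfl
  · intro i _
    have h1 : B (x (Fin.succ i)) (x 0) = 0 := hl _ (b i).2
    rw [Matrix.of_apply, h1]
    simp

variable {G : Type*} [Group G] (X : Type*) [MulAction G X]

variable (H : Subgroup G)

/-- The number of elements of `H` fixing a given point of an orbit. -/
def orbitDegree (ω : MulAction.orbitRel.Quotient H X) : ℕ := Nat.card H / Nat.card ω.orbit

theorem orbitDegree_mul [Finite G] (ω : MulAction.orbitRel.Quotient H X) :
    orbitDegree X H ω * Nat.card ω.orbit = Nat.card H := by
  refine Nat.div_mul_cancel ?_
  induction ω using Quotient.inductionOn' with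
  | h x =>
  rw [MulAction.orbitRel.Quotient.orbit_mk]
  have h := Nat.card_congr (MulAction.orbitProdStabilizerEquivGroup H x)
  rw [Nat.card_prod] at h
  exact ⟨_, h.symm⟩

theorem orbitDegree_mk [Finite G] (x : X) :
    orbitDegree X H (Quotient.mk'' x) = Nat.card (MulAction.stabilizer H x) := by
  have h1 := orbitDegree_mul X H (Quotient.mk'' x)
  have h2 := Nat.card_congr (MulAction.orbitProdStabilizerEquivGroup H x)
  rw [Nat.card_prod, ← h1, MulAction.orbitRel.Quotient.orbit_mk, mul_comm] at h2
  have h3 : Nat.card (MulAction.orbit H x) ≠ 0 := by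
    rw [MulAction.orbitRel.Quotient.orbit_mk] at h1
    exact right_ne_zero_of_mul (h1.trans_ne Nat.card_pos.ne')
  exact (mul_right_cancel₀ h3 h2).symm

theorem orbitDegree_ne_zero [Finite G] (ω : MulAction.orbitRel.Quotient H X) :
    orbitDegree X H ω ≠ 0 := by
  have h := orbitDegree_mul X H ω
  intro h0
  rw [h0, zero_mul] at h
  exact Nat.card_pos.ne h

/-- The basis of points of a permutation module. -/
def pointBasis : Module.Basis X ℤ (MonoidAlgebra ℤ X) :=
  .ofRepr (MonoidAlgebra.coeffLinearEquiv ℤ)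

theorem pointBasis_apply (x : X) : pointBasis X x = MonoidAlgebra.single x 1 := by
  apply (pointBasis X).repr.injective
  rw [(pointBasis X).repr_self]
  rfl

/-- The augmentation of a permutation module. -/
def aug (X : Type*) : MonoidAlgebra ℤ X →ₗ[ℤ] ℤ :=
  Finsupp.linearCombination ℤ (fun _ : X => (1 : ℤ)) ∘ₗ
    (MonoidAlgebra.coeffLinearEquiv ℤ).toLinearMap

variable [Fintype X]

theorem aug_apply (c : MonoidAlgebra ℤ X) : aug X c = ∑ x, c.coeff x := by
  simp [aug, Finsupp.linearCombination_apply, Finsupp.sum_fintype]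

/-- The pairing on a permutation module for which the points are orthonormal. -/
def stdPairing : MonoidAlgebra ℤ X →ₗ[ℤ] MonoidAlgebra ℤ X →ₗ[ℤ] ℂ :=
  LinearMap.mk₂ ℤ (fun c d => ((∑ x, c.coeff x * d.coeff x : ℤ) : ℂ))
    (by intro a x y; simp [add_mul, Finset.sum_add_distrib])
    (by intro a x y; simp [mul_assoc, Finset.mul_sum])
    (by intro x y y'; simp [mul_add, Finset.sum_add_distrib])
    (by intro a x y; simp [mul_left_comm, Finset.mul_sum])

theorem stdPairing_apply (c d : MonoidAlgebra ℤ X) :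
    stdPairing X c d = ((∑ x, c.coeff x * d.coeff x : ℤ) : ℂ) := rfl

instance : Module.Free ℤ (MonoidAlgebra ℤ X) := .of_basis (pointBasis X)

instance : Module.Finite ℤ (MonoidAlgebra ℤ X) := .of_basis (pointBasis X)

theorem latticeDet_stdPairing : latticeDet (MonoidAlgebra ℤ X) (stdPairing X) = 1 := by
  classical
  rw [latticeDet_eq_det_of_basis _ (pointBasis X), ← Matrix.det_one (n := X)]
  congr 1
  ext x y
  simp [stdPairing_apply, pointBasis_apply, Matrix.one_apply, Finsupp.single_apply]

theorem stdPairing_invariant (g : G) (c d : MonoidAlgebra ℤ X) :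
    stdPairing X (Representation.ofMulAction ℤ G X g c) (Representation.ofMulAction ℤ G X g d) =
      stdPairing X c d := by
  simp only [stdPairing_apply, Representation.coeff_ofMulAction]
  congr 1
  exact Fintype.sum_equiv (MulAction.toPerm g⁻¹) _ _ fun x => rfl

theorem isInvariantPairing_stdPairing :
    IsInvariantPairing (Representation.ofMulAction ℤ G X) (stdPairing X) :=
  ⟨stdPairing_invariant X, by rw [latticeDet_stdPairing]; exact one_ne_zero⟩

/-- The invariants of a permutation module are the functions on the set of orbits. -/
def fixedEquiv : fixedBy (Representation.ofMulAction ℤ G X) H ≃ₗ[ℤ]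
    (MulAction.orbitRel.Quotient H X → ℤ) where
  toFun c ω := Quotient.liftOn' ω c.1.coeff (by
    rintro x y ⟨h, rfl⟩
    have h1 := congrArg (fun d => d.coeff (h • y)) (c.2 h)
    refine h1.symm.trans ?_
    refine (Representation.coeff_ofMulAction (h : G) c.1 _).trans ?_
    change c.1.coeff ((h : G)⁻¹ • (h : G) • y) = _
    rw [inv_smul_smul])
  map_add' c d := by
    funext ω
    induction ω using Quotient.inductionOn'
    rfl
  map_smul' a c := by
    funext ω
    induction ω using Quotient.inductionOn'
    rfl
  invFun f := ⟨(MonoidAlgebra.coeffLinearEquiv ℤ).symm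
    (Finsupp.equivFunOnFinite.symm fun x => f (Quotient.mk'' x)), fun h => by
      apply (MonoidAlgebra.coeffLinearEquiv ℤ).injective
      ext x
      refine (Representation.coeff_ofMulAction (h : G) _ _).trans ?_
      change f (Quotient.mk'' ((h : G)⁻¹ • x)) = f (Quotient.mk'' x)
      congr 1
      exact Quotient.sound' ⟨h⁻¹, rfl⟩⟩
  left_inv c := by
    apply Subtype.ext
    apply (MonoidAlgebra.coeffLinearEquiv ℤ).injective
    ext x
    rfl
  right_inv f := by
    funext ω
    induction ω using Quotient.inductionOn'
    rfl

theorem coeff_fixedEquiv_symm (f : MulAction.orbitRel.Quotient H X → ℤ) (x : X) :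
    ((fixedEquiv X H).symm f).1.coeff x = f (Quotient.mk'' x) := rfl

instance : Finite (MulAction.orbitRel.Quotient H X) := Quotient.finite _

variable [Fintype (MulAction.orbitRel.Quotient H X)]

/-- The basis of orbit sums of the invariants of a permutation module. -/
def orbitBasis : Module.Basis (MulAction.orbitRel.Quotient H X) ℤ
    (fixedBy (Representation.ofMulAction ℤ G X) H) :=
  .ofEquivFun (fixedEquiv X H)

theorem sum_eq_sum_orbits {E : Type*} [CommRing E] (f : MulAction.orbitRel.Quotient H X → E) :
    ∑ x : X, f (Quotient.mk'' x) = ∑ ω, (Nat.card ω.orbit : E) * f ω := by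
  classical
  rw [← Finset.sum_fiberwise (s := Finset.univ)
    (g := fun x : X => (Quotient.mk'' x : MulAction.orbitRel.Quotient H X))]
  refine Finset.sum_congr rfl fun ω _ => ?_
  rw [Finset.sum_congr rfl fun x hx => congrArg f (Finset.mem_filter.mp hx).2, Finset.sum_const,
    nsmul_eq_mul]
  congr 2
  rw [Nat.card_eq_card_toFinset]
  congr 1
  ext x
  simp [MulAction.orbitRel.Quotient.mem_orbit]

/-- Orbit sums are orthogonal, and after scaling by `|H|⁻¹` the sum over an orbit has square `|ω| /
|H|`, the inverse of its stabiliser order. -/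
theorem latticeDet_fixed_stdPairing [Finite G] :
    latticeDet (fixedBy (Representation.ofMulAction ℤ G X) H) ((Nat.card H : ℂ)⁻¹ •
      (stdPairing X).domRestrict₁₂ (fixedBy (Representation.ofMulAction ℤ G X) H)
        (fixedBy (Representation.ofMulAction ℤ G X) H)) =
      (∏ ω, (orbitDegree X H ω : ℂ))⁻¹ := by
  classical
  rw [latticeDet_eq_det_of_basis _ (orbitBasis X H), ← Finset.prod_inv_distrib,
    ← Matrix.det_diagonal]
  congr 1
  ext ω ω'
  have h1 : ∀ ω x, ((orbitBasis X H ω).1.coeff x) = if Quotient.mk'' x = ω then 1 else 0 := by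
    intro ω x
    simp only [orbitBasis, Module.Basis.coe_ofEquivFun]
    refine (coeff_fixedEquiv_symm X H _ _).trans ?_
    exact Pi.single_apply _ _ _
  have h2 : stdPairing X (orbitBasis X H ω).1 (orbitBasis X H ω').1 =
      if ω = ω' then (Nat.card ω.orbit : ℂ) else 0 := by
    rw [stdPairing_apply]
    simp only [h1]
    rw [sum_eq_sum_orbits X H fun ν => (if ν = ω then (1 : ℤ) else 0) * if ν = ω' then 1 else 0]
    simp only [mul_ite, mul_one, mul_zero, Finset.sum_ite_eq', Finset.mem_univ, if_true]
    by_cases h : ω = ω'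
    · subst h
      rw [if_pos rfl, if_pos rfl, Int.cast_natCast]
    · rw [if_neg h, if_neg (Ne.symm h), Int.cast_zero]
  rw [Matrix.of_apply, LinearMap.smul_apply, LinearMap.smul_apply, LinearMap.domRestrict₁₂_apply, h2,
    Matrix.diagonal_apply]
  split_ifs with h
  · have h3 := orbitDegree_mul X H ω
    have h4 : (Nat.card H : ℂ) ≠ 0 := Nat.cast_ne_zero.mpr Nat.card_pos.ne'
    have h5 : (orbitDegree X H ω : ℂ) ≠ 0 := Nat.cast_ne_zero.mpr (orbitDegree_ne_zero X H ω)
    rw [smul_eq_mul, ← h3]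
    push_cast
    rw [← h3] at h4
    push_cast at h4
    rw [mul_inv, mul_assoc, inv_mul_cancel₀ (mul_ne_zero_iff.mp h4).2, mul_one]
  · simp

end PermutationLattices

/-! ### Regulator constants of permutation modules and augmentation kernels. -/

noncomputable section PermutationRegulators

variable {G : Type*} [Group G] [Finite G] (X : Type*) [MulAction G X] [Fintype X]

/-- The product of the orders of the point stabilisers in `H`, over the orbits of `H`. -/
def degreeProd (H : Subgroup G) : ℕ := ∏ᶠ ω, orbitDegree X H ω

theorem degreeProd_ne_zero (H : Subgroup G) : (degreeProd X H : ℂ) ≠ 0 := by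
  have := Fintype.ofFinite (MulAction.orbitRel.Quotient H X)
  rw [degreeProd, finprod_eq_prod_of_fintype, Nat.cast_ne_zero]
  exact Finset.prod_ne_zero_iff.mpr fun ω _ => orbitDegree_ne_zero X H ω

theorem latticeDet_fixed_eq_inv (H : Subgroup G) :
    latticeDet (fixedBy (Representation.ofMulAction ℤ G X) H) ((Nat.card H : ℂ)⁻¹ •
      (stdPairing X).domRestrict₁₂ (fixedBy (Representation.ofMulAction ℤ G X) H)
        (fixedBy (Representation.ofMulAction ℤ G X) H)) = (degreeProd X H : ℂ)⁻¹ := by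
  have := Fintype.ofFinite (MulAction.orbitRel.Quotient H X)
  rw [latticeDet_fixed_stdPairing, degreeProd, finprod_eq_prod_of_fintype]
  push_cast
  rfl

theorem regulatorConstant_ofMulAction [Fintype (Subgroup G)] {Θ : Subgroup G → ℤ}
    (hΘ : IsBrauerRelation Θ) : regulatorConstant (Representation.ofMulAction ℤ G X) Θ =
      ∏ H, ((degreeProd X H : ℂ)⁻¹) ^ Θ H := by
  rw [regulatorConstant_eq hΘ (isInvariantPairing_stdPairing X)]
  simp only [latticeDet_fixed_eq_inv]

/-- The scale `c` of the pairing is left free; the choice `c = |X|` later absorbs the factor `|X| /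
|H|` from the augmentation kernel. -/
theorem regulatorConstant_trivial [Fintype (Subgroup G)] {Θ : Subgroup G → ℤ}
    (hΘ : IsBrauerRelation Θ) {c : ℂ} (hc : c ≠ 0) :
    regulatorConstant (Representation.trivial ℤ G ℤ) Θ = ∏ H : Subgroup G, (c / Nat.card H) ^ Θ H := by
  let B : ℤ →ₗ[ℤ] ℤ →ₗ[ℤ] ℂ := LinearMap.mk₂ ℤ (fun x y => c * x * y)
    (by intro x y z; push_cast; ring) (by intro x y z; simp; ring)
    (by intro x y z; push_cast; ring) (by intro x y z; simp; ring)
  have hB : IsInvariantPairing (Representation.trivial ℤ G ℤ) B := by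
    refine ⟨fun g x y => rfl, ?_⟩
    rw [latticeDet_eq_det_of_basis B (Module.Basis.singleton Unit ℤ)]
    simp [B, hc]
  rw [regulatorConstant_eq hΘ hB]
  refine Finset.prod_congr rfl fun H _ => ?_
  have htop : fixedBy (Representation.trivial ℤ G ℤ) H = ⊤ := by
    rw [eq_top_iff]
    exact fun x _ h => rfl
  rw [latticeDet_congr ((LinearEquiv.ofEq _ _ htop).trans Submodule.topEquiv)
    (B' := (Nat.card H : ℂ)⁻¹ • B) fun x y => rfl,
    latticeDet_eq_det_of_basis _ (Module.Basis.singleton Unit ℤ)]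
  congr 1
  simp [B, div_eq_inv_mul]

/-- The orbit sums have augmentations `|H| / d_ω` with `d_ω` the stabiliser orders, and the gcd of
these numbers is `|H|` over the lcm of the `d_ω`. For empty X the image would be zero instead. -/
theorem range_aug_fixed [Nonempty X] (H : Subgroup G) {l : ℕ}
    (hl : ∀ d, l ∣ d ↔ ∀ ω, orbitDegree X H ω ∣ d) :
    LinearMap.range (aug X ∘ₗ (fixedBy (Representation.ofMulAction ℤ G X) H).subtype) =
      Ideal.span {((Nat.card H / l : ℕ) : ℤ)} := by
  classical
  have := Fintype.ofFinite (MulAction.orbitRel.Quotient H X)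
  let ε := aug X ∘ₗ (fixedBy (Representation.ofMulAction ℤ G X) H).subtype
  have hε : ∀ c, ε c = ∑ ω, (Nat.card ω.orbit : ℤ) * fixedEquiv X H c ω := by
    intro c
    rw [← sum_eq_sum_orbits X H (fixedEquiv X H c)]
    exact aug_apply X _
  have hlH : l ∣ Nat.card H := (hl _).mpr fun ω => ⟨_, (orbitDegree_mul X H ω).symm⟩
  have hHpos : 0 < Nat.card H := Nat.card_pos
  have hlpos : 0 < l := Nat.pos_of_dvd_of_pos hlH hHpos
  obtain ⟨m, hm⟩ := hlH
  have hmdiv : Nat.card H / l = m := by rw [hm, Nat.mul_div_cancel_left _ hlpos]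
  rw [hmdiv]
  have hmω : ∀ ω : MulAction.orbitRel.Quotient H X, m ∣ Nat.card ω.orbit := by
    intro ω
    obtain ⟨t, ht⟩ := (hl l).mp dvd_rfl ω
    have h1 := orbitDegree_mul X H ω
    rw [hm, ht, mul_assoc] at h1
    exact ⟨t, by rw [mul_comm m]; exact mul_left_cancel₀ (orbitDegree_ne_zero X H ω) h1⟩
  apply le_antisymm
  · rintro _ ⟨c, rfl⟩
    rw [Ideal.mem_span_singleton]
    change (m : ℤ) ∣ ε c
    rw [hε]
    exact Finset.dvd_sum fun ω _ => Dvd.dvd.mul_right (Int.natCast_dvd_natCast.mpr (hmω ω)) _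
  · obtain ⟨a, ha⟩ := (IsPrincipalIdealRing.principal (LinearMap.range ε : Ideal ℤ)).principal
    rw [Ideal.span_singleton_le_iff_mem]
    change (m : ℤ) ∈ LinearMap.range ε
    rw [ha]
    refine Ideal.mem_span_singleton.mpr ?_
    -- A generator `a` of the image divides all orbit sizes, so every `d_ω`, and with them `l`,
    -- divides `|H| / a`; hence `a` divides `|H| / l`.
    have haω : ∀ ω : MulAction.orbitRel.Quotient H X, a.natAbs ∣ Nat.card ω.orbit := by
      intro ω
      have h1 : ε (orbitBasis X H ω) ∈ LinearMap.range ε := ⟨_, rfl⟩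
      rw [ha] at h1
      have h2 : a ∣ ε (orbitBasis X H ω) := Ideal.mem_span_singleton.mp h1
      rw [hε, Finset.sum_eq_single_of_mem ω (Finset.mem_univ ω)] at h2
      · have h3 : fixedEquiv X H (orbitBasis X H ω) ω = 1 := by
          simp [orbitBasis]
        rw [h3, mul_one] at h2
        exact Int.natAbs_dvd_natAbs.mpr h2
      · intro ν _ hν
        have h3 : fixedEquiv X H (orbitBasis X H ω) ν = 0 := by
          simp [orbitBasis, hν]
        rw [h3, mul_zero]
    obtain ⟨x⟩ := ‹Nonempty X›
    have haH : a.natAbs ∣ Nat.card H := by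
      rw [← orbitDegree_mul X H (Quotient.mk'' x)]
      exact Dvd.dvd.mul_left (haω _) _
    obtain ⟨t, ht⟩ := haH
    have hapos : 0 < a.natAbs := Nat.pos_of_ne_zero fun h => by
      rw [h, zero_mul] at ht
      exact hHpos.ne' ht
    have hlt : l ∣ t := (hl t).mpr fun ω => by
      obtain ⟨s, hs⟩ := haω ω
      have h1 := orbitDegree_mul X H ω
      rw [ht, hs, mul_left_comm] at h1
      exact ⟨s, (mul_left_cancel₀ hapos.ne' h1).symm⟩
    obtain ⟨s, hs⟩ := hlt
    rw [← Int.natAbs_dvd, Int.natCast_dvd_natCast]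
    refine ⟨s, ?_⟩
    rw [hm, hs, mul_left_comm] at ht
    exact mul_left_cancel₀ hlpos.ne' ht

/-- The sum of all points is orthogonal to the kernel. The formula shows that the standard pairing
stays non-degenerate there. -/
theorem latticeDet_ker_aug [Nonempty X] :
    (Fintype.card X : ℂ) * latticeDet (LinearMap.ker (aug X))
      ((stdPairing X).domRestrict₁₂ (LinearMap.ker (aug X)) (LinearMap.ker (aug X))) =
      (Fintype.card X : ℂ) ^ 2 := by
  classical
  let σ : MonoidAlgebra ℤ X := (MonoidAlgebra.coeffLinearEquiv ℤ).symm
    (Finsupp.equivFunOnFinite.symm fun _ => 1)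
  have hσ : ∀ x, σ.coeff x = 1 := fun x => rfl
  have hrange : LinearMap.range (aug X) = Ideal.span {(1 : ℤ)} := by
    rw [Ideal.span_singleton_one]
    refine LinearMap.range_eq_top.mpr fun n => ?_
    obtain ⟨x⟩ := ‹Nonempty X›
    exact ⟨MonoidAlgebra.single x n, by simp [aug_apply, Finsupp.single_apply]⟩
  have h := latticeDet_ker (stdPairing X) (aug X) (a := 1) (q := Fintype.card X) (σ := σ) one_ne_zero
    hrange (by simp [aug_apply, hσ]) (by
      intro c hc
      rw [stdPairing_apply]
      simp only [hσ, mul_one, ← aug_apply, hc, Int.cast_zero])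
  rw [latticeDet_stdPairing, mul_one] at h
  have h1 : stdPairing X σ σ = Fintype.card X := by
    rw [stdPairing_apply]
    simp [hσ]
  rw [h1] at h
  exact_mod_cast h

/-- `latticeDet_ker` is applied with `σ` the sum of all points: `σ` has square `|X| / |H|` and
augmentation `|X|`, which is `q = |X| l / |H|` times the generator `|H| / l` of the image. -/
theorem latticeDet_ker_aug_fixed [Nonempty X] (H : Subgroup G) {l : ℕ}
    (hl : ∀ d, l ∣ d ↔ ∀ ω, orbitDegree X H ω ∣ d) :
    latticeDet (LinearMap.ker (aug X ∘ₗ (fixedBy (Representation.ofMulAction ℤ G X) H).subtype))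
      (((Nat.card H : ℂ)⁻¹ • (stdPairing X).domRestrict₁₂ (fixedBy (Representation.ofMulAction ℤ G X) H)
        (fixedBy (Representation.ofMulAction ℤ G X) H)).domRestrict₁₂
          (LinearMap.ker (aug X ∘ₗ (fixedBy (Representation.ofMulAction ℤ G X) H).subtype))
          (LinearMap.ker (aug X ∘ₗ (fixedBy (Representation.ofMulAction ℤ G X) H).subtype))) =
      (Fintype.card X : ℂ) / Nat.card H * (l ^ 2 / degreeProd X H) := by
  classical
  have := Fintype.ofFinite (MulAction.orbitRel.Quotient H X)
  have hfree : Module.Free ℤ (fixedBy (Representation.ofMulAction ℤ G X) H) :=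
    .of_basis (orbitBasis X H)
  have hlH : l ∣ Nat.card H := (hl _).mpr fun ω => ⟨_, (orbitDegree_mul X H ω).symm⟩
  have hHpos : 0 < Nat.card H := Nat.card_pos
  have hlpos : 0 < l := Nat.pos_of_dvd_of_pos hlH hHpos
  obtain ⟨m, hm⟩ := hlH
  have hmdiv : Nat.card H / l = m := by rw [hm, Nat.mul_div_cancel_left _ hlpos]
  have hmpos : m ≠ 0 := by
    rintro rfl
    exact hHpos.ne' hm
  have hrange := range_aug_fixed X H hl
  rw [hmdiv] at hrange
  let σ : fixedBy (Representation.ofMulAction ℤ G X) H := (fixedEquiv X H).symm fun _ => 1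
  have hσ : ∀ x, σ.1.coeff x = 1 := fun x => rfl
  have hσε : (aug X ∘ₗ (fixedBy (Representation.ofMulAction ℤ G X) H).subtype) σ =
      Fintype.card X := by
    change aug X σ.1 = _
    simp [aug_apply, hσ]
  obtain ⟨q, hq⟩ : (m : ℤ) ∣ Fintype.card X := by
    have h1 := LinearMap.mem_range_self
      (aug X ∘ₗ (fixedBy (Representation.ofMulAction ℤ G X) H).subtype) σ
    rw [hrange, hσε] at h1
    exact Ideal.mem_span_singleton.mp h1
  have h := latticeDet_ker ((Nat.card H : ℂ)⁻¹ • (stdPairing X).domRestrict₁₂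
    (fixedBy (Representation.ofMulAction ℤ G X) H) (fixedBy (Representation.ofMulAction ℤ G X) H))
    (aug X ∘ₗ (fixedBy (Representation.ofMulAction ℤ G X) H).subtype) (a := m) (q := q) (σ := σ)
    (Int.natCast_ne_zero.mpr hmpos) hrange (by rw [hσε, hq, mul_comm]) (by
      intro c hc
      rw [LinearMap.smul_apply, LinearMap.smul_apply, LinearMap.domRestrict₁₂_apply,
        stdPairing_apply]
      have h2 : ∑ x, c.1.coeff x = 0 := (aug_apply X _).symm.trans hc
      simp only [hσ, mul_one, h2, Int.cast_zero, smul_zero])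
  rw [latticeDet_fixed_eq_inv] at h
  have h1 : ((Nat.card H : ℂ)⁻¹ • (stdPairing X).domRestrict₁₂
    (fixedBy (Representation.ofMulAction ℤ G X) H)
      (fixedBy (Representation.ofMulAction ℤ G X) H)) σ σ = Fintype.card X / Nat.card H := by
    rw [LinearMap.smul_apply, LinearMap.smul_apply, LinearMap.domRestrict₁₂_apply, stdPairing_apply]
    simp [hσ, div_eq_inv_mul]
  rw [h1] at h
  have hX : (Fintype.card X : ℂ) ≠ 0 := Nat.cast_ne_zero.mpr Fintype.card_ne_zero
  have hH : (Nat.card H : ℂ) ≠ 0 := Nat.cast_ne_zero.mpr hHpos.ne'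
  have hqX : (Fintype.card X : ℂ) / Nat.card H * l = q := by
    have h2 : (Fintype.card X : ℂ) = m * q := by exact_mod_cast hq
    have h3 : (Nat.card H : ℂ) = l * m := by exact_mod_cast hm
    have hl0 : (l : ℂ) ≠ 0 := Nat.cast_ne_zero.mpr hlpos.ne'
    have hm0 : (m : ℂ) ≠ 0 := Nat.cast_ne_zero.mpr hmpos
    rw [h2, h3]
    field_simp
  apply mul_left_cancel₀ (div_ne_zero hX hH)
  rw [h, ← hqX]
  have := degreeProd_ne_zero X H
  ring

variable {X}

/-- The regulator constant of the augmentation kernel of a permutation module. -/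
theorem regulatorConstant_augKernel [Nonempty X] [Fintype (Subgroup G)]
    (A : Subrepresentation (Representation.ofMulAction ℤ G X))
    (hA : A.toSubmodule = LinearMap.ker (aug X)) [Module.Finite ℤ A.toSubmodule]
    {l : Subgroup G → ℕ} (hl : ∀ H d, l H ∣ d ↔ ∀ ω, orbitDegree X H ω ∣ d)
    {Θ : Subgroup G → ℤ} (hΘ : IsBrauerRelation Θ) :
    regulatorConstant A.toRepresentation Θ =
      regulatorConstant (Representation.trivial ℤ G ℤ) Θ *
        ∏ H, ((l H : ℂ) ^ 2 / degreeProd X H) ^ Θ H := by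
  have hX : (Fintype.card X : ℂ) ≠ 0 := Nat.cast_ne_zero.mpr Fintype.card_ne_zero
  let B := (stdPairing X).domRestrict₁₂ A.toSubmodule A.toSubmodule
  have hfreeA : Module.Free ℤ A.toSubmodule := inferInstance
  have hB : IsInvariantPairing A.toRepresentation B := by
    refine ⟨fun g x y => stdPairing_invariant X g x.1 y.1, ?_⟩
    have h1 : latticeDet A.toSubmodule B = latticeDet (LinearMap.ker (aug X))
        ((stdPairing X).domRestrict₁₂ (LinearMap.ker (aug X)) (LinearMap.ker (aug X))) :=
      latticeDet_congr (LinearEquiv.ofEq _ _ hA) fun x y => rfl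
    rw [h1]
    intro h0
    have h2 := latticeDet_ker_aug X
    rw [h0, mul_zero] at h2
    exact pow_ne_zero 2 hX h2.symm
  rw [regulatorConstant_eq hΘ hB, regulatorConstant_trivial hΘ hX, ← Finset.prod_mul_distrib]
  refine Finset.prod_congr rfl fun H _ => ?_
  rw [← mul_zpow, ← latticeDet_ker_aug_fixed X H (hl H)]
  congr 1
  -- The invariants of the kernel are the kernel of the augmentation on the invariants.
  let e : fixedBy A.toRepresentation H ≃ₗ[ℤ]
      LinearMap.ker (aug X ∘ₗ (fixedBy (Representation.ofMulAction ℤ G X) H).subtype) :=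
    { toFun := fun c => ⟨⟨c.1.1, fun h => congrArg Subtype.val (c.2 h)⟩,
        (hA ▸ c.1.2 : c.1.1 ∈ LinearMap.ker (aug X))⟩
      map_add' := fun c d => rfl
      map_smul' := fun a c => rfl
      invFun := fun c => ⟨⟨c.1.1, hA ▸ (c.2 : c.1.1 ∈ LinearMap.ker (aug X))⟩,
        fun h => Subtype.ext (c.1.2 h)⟩
      left_inv := fun c => rfl
      right_inv := fun c => rfl }
  exact latticeDet_congr e fun x y => rfl

end PermutationRegulators

/-! ### Decomposition of a G-set into coset spaces. -/

section Transversals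

variable {G : Type*} [Group G] [Finite G] {X : Type*} [MulAction G X] [Fintype X]

/-- The stabiliser orders of a disjoint union of `G`-sets. -/
theorem degreeProd_of_decomposition {ι : Type*} [Finite ι] {Y : ι → Type*} [∀ p, MulAction G (Y p)]
    [∀ p, Finite (Y p)] (φ : ∀ p, Y p → X) (hφ : ∀ p (g : G) y, φ p (g • y) = g • φ p y)
    (hinj : ∀ p, Function.Injective (φ p)) (hsurj : ∀ x, ∃ p y, φ p y = x)
    (hdisj : ∀ p q (g : G) a b, g • φ q b = φ p a → p = q) (H : Subgroup G) :
    degreeProd X H = ∏ᶠ p, degreeProd (Y p) H := by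
  have := Fintype.ofFinite ι
  have := fun p => Fintype.ofFinite (Y p)
  have := Fintype.ofFinite (MulAction.orbitRel.Quotient H X)
  have := fun p => Fintype.ofFinite (MulAction.orbitRel.Quotient H (Y p))
  simp only [degreeProd, finprod_eq_prod_of_fintype]
  rw [← Fintype.prod_sigma']
  let F : (Σ p, MulAction.orbitRel.Quotient H (Y p)) → MulAction.orbitRel.Quotient H X := fun ω =>
    Quotient.map' (φ ω.1) (by
      rintro a b ⟨h, rfl⟩
      exact ⟨h, (hφ _ h b).symm⟩) ω.2
  symm
  refine Fintype.prod_bijective F ⟨?_, ?_⟩ _ _ ?_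
  · rintro ⟨p, ω⟩ ⟨q, ν⟩ hF
    induction ω using Quotient.inductionOn' with
    | h a =>
    induction ν using Quotient.inductionOn' with
    | h b =>
    obtain ⟨h, hh⟩ := Quotient.exact' hF
    obtain rfl := hdisj p q h a b hh
    congr 1
    exact Quotient.sound' ⟨h, hinj p ((hφ p h b).trans hh)⟩
  · intro ω
    induction ω using Quotient.inductionOn' with
    | h x =>
    obtain ⟨p, y, rfl⟩ := hsurj x
    exact ⟨⟨p, Quotient.mk'' y⟩, rfl⟩
  · rintro ⟨p, ω⟩
    induction ω using Quotient.inductionOn' with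
    | h a =>
    have h1 : F ⟨p, Quotient.mk'' a⟩ = Quotient.mk'' (φ p a) := rfl
    rw [h1, orbitDegree_mk, orbitDegree_mk]
    congr 2
    ext h
    rw [MulAction.mem_stabilizer_iff, MulAction.mem_stabilizer_iff, Subgroup.smul_def,
      Subgroup.smul_def, ← hφ]
    exact (hinj p).eq_iff.symm

/-- X is the disjoint union of the orbits of the `P p`, each isomorphic to `G ⧸ D p`. The subgroups
`D p` are only assumed equal to stabilisers because decomposition groups are stabilisers in the set
of all places, not in S. -/
theorem degreeProd_transversal {ι : Type*} [Finite ι] (P : ι → X)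
    (hP : ∀ x, ∃ p, x ∈ MulAction.orbit G (P p))
    (hP' : ∀ p q, P q ∈ MulAction.orbit G (P p) → p = q) (D : ι → Subgroup G)
    (hD : ∀ p, D p = MulAction.stabilizer G (P p)) (H : Subgroup G) :
    degreeProd X H = ∏ᶠ p, degreeProd (G ⧸ D p) H := by
  obtain rfl : D = fun p => MulAction.stabilizer G (P p) := funext hD
  refine degreeProd_of_decomposition (fun p => MulAction.ofQuotientStabilizer G (P p))
    (fun p g y => MulAction.ofQuotientStabilizer_smul G (P p) g y)
    (fun p => MulAction.injective_ofQuotientStabilizer G (P p)) ?_ ?_ H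
  · intro x
    obtain ⟨p, g, rfl⟩ := hP x
    exact ⟨p, (g : G ⧸ MulAction.stabilizer G (P p)), rfl⟩
  · intro p q g a b h
    obtain ⟨a, rfl⟩ := QuotientGroup.mk_surjective a
    obtain ⟨b, rfl⟩ := QuotientGroup.mk_surjective b
    refine hP' p q ⟨b⁻¹ * g⁻¹ * a, ?_⟩
    have h2 : g • b • P q = a • P p := h
    change (b⁻¹ * g⁻¹ * a) • P p = P q
    rw [mul_smul, mul_smul, ← h2, inv_smul_smul, inv_smul_smul]

theorem prod_regulatorConstant_transversal [Fintype (Subgroup G)] {ι : Type*} [Finite ι] (P : ι → X)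
    (hP : ∀ x, ∃ p, x ∈ MulAction.orbit G (P p))
    (hP' : ∀ p q, P q ∈ MulAction.orbit G (P p) → p = q) (D : ι → Subgroup G)
    (hD : ∀ p, D p = MulAction.stabilizer G (P p)) {Θ : Subgroup G → ℤ}
    (hΘ : IsBrauerRelation Θ) :
    ∏ᶠ p, regulatorConstant (Representation.ofMulAction ℤ G (G ⧸ D p)) Θ =
      ∏ H, ((degreeProd X H : ℂ)⁻¹) ^ Θ H := by
  have := Fintype.ofFinite ι
  have := fun p => Fintype.ofFinite (G ⧸ D p)
  rw [finprod_eq_prod_of_fintype]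
  rw [Finset.prod_congr rfl fun p _ => regulatorConstant_ofMulAction (G ⧸ D p) hΘ, Finset.prod_comm]
  refine Finset.prod_congr rfl fun H _ => ?_
  rw [degreeProd_transversal P hP hP' D hD H, finprod_eq_prod_of_fintype, Finset.prod_zpow,
    Finset.prod_inv_distrib, Nat.cast_prod]

end Transversals

/-! ### Places below, Galois orbits and local degrees. -/

section PlacesOfExtensions

variable {F K : Type*} [Field F] [Field K] [Algebra F K]

theorem smul_inl (g : Gal(K/F)) [NumberField K] (v : InfinitePlace K) :
    g • (Sum.inl v : Place K) = Sum.inl (g • v) := rfl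

theorem smul_inr (g : Gal(K/F)) [NumberField K] (v : HeightOneSpectrum (𝓞 K)) :
    g • (Sum.inr v : Place K) = Sum.inr (g • v) := rfl

variable [NumberField F] [NumberField K] [IsGalois F K]

/-- The places above a given place form one Galois orbit. -/
theorem below_eq_iff (x y : Place K) :
    Place.below F x = Place.below F y ↔ ∃ g : Gal(K/F), g • x = y := by
  have hI : ∀ v w : InfinitePlace K, v.comap (algebraMap F K) = w.comap (algebraMap F K) ↔
      ∃ g : Gal(K/F), g • v = w := fun v w => InfinitePlace.mem_orbit_iff.symm
  have hE : ∀ v w : HeightOneSpectrum (𝓞 K), v.under (𝓞 F) = w.under (𝓞 F) ↔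
      ∃ g : Gal(K/F), g • v = w := by
    intro v w
    constructor
    · intro h
      have := v.isPrime
      have := w.isPrime
      obtain ⟨g, hg⟩ := Algebra.IsInvariant.exists_smul_of_under_eq (𝓞 F) (𝓞 K) Gal(K/F)
        v.asIdeal w.asIdeal (congrArg HeightOneSpectrum.asIdeal h)
      exact ⟨g, HeightOneSpectrum.ext hg.symm⟩
    · rintro ⟨g, rfl⟩
      apply HeightOneSpectrum.ext
      exact (Ideal.under_smul (𝓞 F) v.asIdeal g).symm
  rcases x with v | v <;> rcases y with w | w
  · simp only [Place.below, Sum.inl.injEq, hI, smul_inl]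
  · simp [Place.below]
  · simp [Place.below]
  · simp only [Place.below, Sum.inr.injEq, hE, smul_inr]

/-- The decomposition group has order `ef` at a finite place; at an Archimedean place it has order 1
or 2, the latter exactly under ramification. -/
theorem localDegree_below (x : Place K) :
    localDegree K (Place.below F x) = Nat.card (MulAction.stabilizer Gal(K/F) x) := by
  rcases x with v | v
  · have h1 : MulAction.stabilizer Gal(K/F) (Sum.inl v : Place K) =
        MulAction.stabilizer Gal(K/F) v := by
      ext g
      simp [MulAction.mem_stabilizer_iff]
    rw [h1, InfinitePlace.card_stabilizer]
    classical
    change ite _ 1 2 = _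
    by_cases h : v.IsUnramified F
    · rw [if_pos h, if_pos (InfinitePlace.isUnramifiedIn_comap.mpr h)]
    · rw [if_neg h, if_neg (mt InfinitePlace.isUnramifiedIn_comap.mp h)]
  · have := v.isPrime
    have := (v.under (𝓞 F)).isPrime
    have h0 : v.asIdeal.LiesOver (v.under (𝓞 F)).asIdeal := ⟨rfl⟩
    have h1 : MulAction.stabilizer Gal(K/F) (Sum.inr v : Place K) =
        MulAction.stabilizer Gal(K/F) v.asIdeal := by
      ext g
      rw [MulAction.mem_stabilizer_iff, MulAction.mem_stabilizer_iff, smul_inr, Sum.inr.injEq,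
        HeightOneSpectrum.ext_iff]
      rfl
    rw [h1, Ideal.card_stabilizer_eq (v.under (𝓞 F)).asIdeal v.asIdeal]
    rfl

end PlacesOfExtensions

/-! ### Places and S-units of the fixed fields. -/

section FixedFields

variable {k K : Type*} [Field k] [Field K] [NumberField K] [Algebra k K]
  [FiniteDimensional k K] (H : Subgroup Gal(K/k))

theorem subgroupEquivAlgEquiv_smul (h : H) (x : Place K) :
    IntermediateField.subgroupEquivAlgEquiv H h • x = h • x := by
  rcases x with v | v
  · rfl
  · rfl

variable [NumberField k] [IsGalois k K]

theorem below_fixedField_eq_iff (x y : Place K) :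
    Place.below (IntermediateField.fixedField H) x = Place.below (IntermediateField.fixedField H) y ↔
      ∃ h : H, h • x = y := by
  rw [below_eq_iff]
  constructor
  · rintro ⟨g, rfl⟩
    obtain ⟨h, rfl⟩ := (IntermediateField.subgroupEquivAlgEquiv H).surjective g
    exact ⟨h, (subgroupEquivAlgEquiv_smul H h x).symm⟩
  · rintro ⟨h, rfl⟩
    exact ⟨IntermediateField.subgroupEquivAlgEquiv H h, subgroupEquivAlgEquiv_smul H h x⟩

theorem localDegree_below_fixedField (x : Place K) :
    localDegree K (Place.below (IntermediateField.fixedField H) x) =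
      Nat.card (MulAction.stabilizer H x) := by
  rw [localDegree_below]
  refine (Nat.card_congr ((IntermediateField.subgroupEquivAlgEquiv H).toEquiv.subtypeEquiv
    fun h => ?_)).symm
  rw [MulAction.mem_stabilizer_iff, MulAction.mem_stabilizer_iff]
  exact (congrArg (· = x) (subgroupEquivAlgEquiv_smul H h x)).to_iff.symm

variable (S : SubMulAction Gal(K/k) (Place K))

/-- The places of the fixed field of `H` below `S` are the orbits of `H` on `S`. -/
noncomputable def orbitsEquivFixedPlaces :
    MulAction.orbitRel.Quotient H S ≃ fixedPlaces S H :=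
  .ofBijective
    (fun ω => Quotient.liftOn' ω
      (fun x => ⟨Place.below (IntermediateField.fixedField H) (x : Place K), x, x.2, rfl⟩) (by
        rintro x y ⟨h, rfl⟩
        exact Subtype.ext (((below_fixedField_eq_iff H _ _).mpr ⟨h, rfl⟩).symm)))
    (by
      constructor
      · intro ω ν h
        induction ω using Quotient.inductionOn' with
        | h x =>
        induction ν using Quotient.inductionOn' with
        | h y =>
        obtain ⟨h, hh⟩ := (below_fixedField_eq_iff H _ _).mp (congrArg Subtype.val h).symm
        exact Quotient.sound' ⟨h, Subtype.ext hh⟩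
      · rintro ⟨_, x, hx, rfl⟩
        exact ⟨Quotient.mk'' ⟨x, hx⟩, rfl⟩)

theorem localDegree_orbitsEquivFixedPlaces (ω : MulAction.orbitRel.Quotient H S) :
    localDegree K (orbitsEquivFixedPlaces H S ω : Place (IntermediateField.fixedField H)) =
      orbitDegree S H ω := by
  induction ω using Quotient.inductionOn' with
  | h x =>
  refine (localDegree_below_fixedField H (x : Place K)).trans ?_
  rw [orbitDegree_mk]
  congr 2
  ext h
  rw [MulAction.mem_stabilizer_iff, MulAction.mem_stabilizer_iff, Subtype.ext_iff]
  rfl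

theorem nProd_eq : nProd S H = degreeProd S H := by
  rw [nProd, degreeProd]
  refine (finprod_eq_of_bijective (orbitsEquivFixedPlaces H S) (orbitsEquivFixedPlaces H S).bijective
    fun ω => ?_).symm
  exact (localDegree_orbitsEquivFixedPlaces H S ω).symm

/-- This characterisation by divisibility is the form in which `l` enters the computation of the
augmentation image. -/
theorem lLcm_dvd_iff [Finite S] (d : ℕ) : lLcm S H ∣ d ↔ ∀ ω, orbitDegree S H ω ∣ d := by
  let := Fintype.ofFinite (fixedPlaces S H)
  change Finset.univ.lcm _ ∣ d ↔ _
  rw [Finset.lcm_dvd_iff]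
  constructor
  · intro h ω
    rw [← localDegree_orbitsEquivFixedPlaces]
    exact h _ (Finset.mem_univ _)
  · intro h p _
    obtain ⟨ω, rfl⟩ := (orbitsEquivFixedPlaces H S).surjective p
    rw [localDegree_orbitsEquivFixedPlaces]
    exact h ω

/-- The group of `S`-units of the fixed field of `H` consists of the `H`-invariant `S`-units. -/
theorem mem_fixedUnits_iff (u : Kˣ) :
    u ∈ fixedUnits S H ↔ u ∈ unitsOf S ∧ ∀ h : H, (h : Gal(K/k)) (u : K) = u := by
  -- The valuation above is the power of the valuation below with exponent the ramification index,
  -- which is nonzero; so both are trivial at the same elements.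
  have hval : ∀ (v : HeightOneSpectrum (𝓞 K)) (x : IntermediateField.fixedField H),
      v.valuation K (algebraMap _ K x) = 1 ↔
        (v.under (𝓞 (IntermediateField.fixedField H))).valuation
          (IntermediateField.fixedField H) x = 1 := by
    intro v x
    have h0 : v.asIdeal.LiesOver (v.under (𝓞 (IntermediateField.fixedField H))).asIdeal := ⟨rfl⟩
    rw [← HeightOneSpectrum.valuation_liesOver K
      (v.under (𝓞 (IntermediateField.fixedField H))) v x]
    exact pow_eq_one_iff.trans (or_iff_left <|
      Ideal.IsDedekindDomain.ramificationIdx'_ne_zero_of_liesOver v.asIdeal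
      (v.under (𝓞 (IntermediateField.fixedField H))).ne_bot)
  have hS : ∀ v : HeightOneSpectrum (𝓞 K), v ∈ finitePart (S : Set (Place K)) ↔
      v.under (𝓞 (IntermediateField.fixedField H)) ∈ finitePart (fixedPlaces S H) := by
    intro v
    constructor
    · intro hv
      exact ⟨Sum.inr v, hv, rfl⟩
    · rintro ⟨x, hx, hxv⟩
      obtain ⟨h, hh⟩ := (below_fixedField_eq_iff H x (Sum.inr v)).mp hxv
      change (Sum.inr v : Place K) ∈ S
      rw [← hh]
      exact S.smul_mem (h : Gal(K/k)) hx
  constructor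
  · rintro ⟨x, hx, rfl⟩
    refine ⟨fun v hv => ?_, fun h => x.1.2 h⟩
    exact (hval v x).mpr (hx _ fun h => hv ((hS v).mpr h))
  · rintro ⟨hu, hfix⟩
    let x : (IntermediateField.fixedField H)ˣ := Units.mk0 ⟨u, fun h => hfix h⟩
      fun h => u.ne_zero (congrArg Subtype.val h)
    refine ⟨x, fun p hp => ?_, Units.ext rfl⟩
    -- Lying over: conditions at primes of the fixed field can be tested at primes of K.
    obtain ⟨P, hP⟩ : ∃ P : HeightOneSpectrum (𝓞 K),
        P.under (𝓞 (IntermediateField.fixedField H)) = p := by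
      have := p.isPrime
      obtain ⟨Q, hQ, hQp⟩ := p.asIdeal.exists_ideal_over_prime_of_isIntegral_of_isDomain
        (S := 𝓞 K) (by simp)
      refine ⟨⟨Q, hQ, ?_⟩, HeightOneSpectrum.ext hQp⟩
      rintro rfl
      exact p.ne_bot (by rw [← hQp]; simp)
    subst hP
    exact (hval P x).mp (hu P fun h => hp ((hS P).mp h))

end FixedFields

/-! ### Lattice determinants and finite index. -/

section Index

variable {N N' : Type*} [AddCommGroup N] [AddCommGroup N'] [Module.Finite ℤ N] [Module.Finite ℤ N']
  [Module.Free ℤ N']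

/-- The image of the free module meets the torsion trivially, so its index in N is the order of the
torsion times the index in `N/tors`. Only the latter index, squared, scales the Gram determinant. -/
theorem latticeDet_comap (B : N →ₗ[ℤ] N →ₗ[ℤ] ℂ) {φ : N' →ₗ[ℤ] N} (hφ : Function.Injective φ)
    (hfin : φ.toAddMonoidHom.range.index ≠ 0) :
    latticeDet N' (B.compl₁₂ φ φ) * (Nat.card (Submodule.torsion ℤ N) : ℂ) ^ 2 =
      (φ.toAddMonoidHom.range.index : ℂ) ^ 2 * latticeDet N B := by
  let T := Submodule.torsion ℤ N
  let ψ := T.mkQ ∘ₗ φ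
  have htf : ∀ x, φ x ∈ T → x = 0 := by
    intro x hx
    obtain ⟨n, hn⟩ := (Submodule.mem_torsion_iff _).mp hx
    have h1 : φ ((n : ℤ) • x) = 0 := (map_smul φ (n : ℤ) x).trans hn
    exact (smul_eq_zero.mp (hφ (h1.trans (map_zero φ).symm))).resolve_left
      (nonZeroDivisors.ne_zero n.2)
  have hψ : Function.Injective ψ := by
    rw [injective_iff_map_eq_zero]
    exact fun x hx => htf x ((Submodule.Quotient.mk_eq_zero _).mp hx)
  have h1 : φ.toAddMonoidHom.range.index =
      Nat.card T * ψ.toAddMonoidHom.range.index := by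
    have h2 : ψ.toAddMonoidHom.range = φ.toAddMonoidHom.range.map T.mkQ.toAddMonoidHom :=
      (AddMonoidHom.map_range T.mkQ.toAddMonoidHom φ.toAddMonoidHom).symm
    have h3 : T.mkQ.toAddMonoidHom.ker = T.toAddSubgroup := by
      ext x
      exact Submodule.Quotient.mk_eq_zero _
    have h4 : T.mkQ.toAddMonoidHom.range = ⊤ :=
      AddMonoidHom.range_eq_top.mpr T.mkQ_surjective
    have h5 : φ.toAddMonoidHom.range ⊓ T.toAddSubgroup = ⊥ := by
      rw [eq_bot_iff]
      rintro _ ⟨⟨x, rfl⟩, hx⟩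
      have := htf x hx
      subst this
      exact map_zero φ
    rw [h2, AddSubgroup.index_map, h3, h4, AddSubgroup.index_top, mul_one,
      ← AddSubgroup.relIndex_mul_index (le_sup_left : _ ≤ _ ⊔ T.toAddSubgroup)]
    congr 1
    rw [sup_comm, AddSubgroup.relIndex_sup_right, ← AddSubgroup.inf_relIndex_right, h5,
      AddSubgroup.relIndex_bot_left]
    rfl
  have h0 : ψ.toAddMonoidHom.range.index ≠ 0 := fun h => hfin (by rw [h1, h, mul_zero])
  let b := Module.finBasis ℤ (N ⧸ T)
  have hQ : Finite ((N ⧸ T) ⧸ LinearMap.range ψ) := Nat.finite_of_card_ne_zero h0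
  let e := LinearEquiv.ofInjective ψ hψ
  have hrank : Module.finrank ℤ N' = Module.finrank ℤ (N ⧸ T) :=
    e.finrank_eq.trans ((Submodule.finiteQuotient_iff _).mp hQ)
  let c : Module.Basis (Fin (Module.finrank ℤ (N ⧸ T))) ℤ N' := Module.finBasisOfFinrankEq ℤ N' hrank
  -- The index of a full sublattice is the absolute value of the determinant of a basis of it.
  have h6 : (b.det (fun i => ψ (c i))).natAbs = ψ.toAddMonoidHom.range.index :=
    Submodule.natAbs_det_basis_change b (LinearMap.range ψ) (c.map e)
  have h7 := det_gram_of_coordinates B (fun i => φ (c i)) (fun i => (b i).out)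
    (b.toMatrix fun i => ψ (c i)).transpose (fun i => by
      simp only [mkQ_out, Matrix.transpose_apply]
      exact (b.sum_toMatrix_smul_self (fun i => ψ (c i)) i).symm)
  rw [latticeDet_eq_det_of_basis _ c, h1, ← h6]
  have h8 : ((b.det fun i => ψ (c i)).natAbs : ℂ) ^ 2 = ((b.toMatrix fun i => ψ (c i)).det : ℂ) ^ 2 := by
    rw [← Module.Basis.det_apply]
    rw [← Int.cast_pow, ← Int.natAbs_sq, Int.cast_pow, Int.cast_natCast]
  push_cast
  rw [mul_pow, h8, mul_assoc, mul_comm]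
  congr 1
  rw [Matrix.det_transpose] at h7
  exact h7
end Index

/-! ### S-units, roots of unity and comparison with the augmentation kernel. -/

section Units

variable {k K : Type*} [Field k] [Field K] [NumberField K] [Algebra k K]
  (S : SubMulAction Gal(K/k) (Place K))

theorem mem_unitsOf_of_pow_eq_one {u : Kˣ} {n : ℕ} (hn : n ≠ 0) (hu : u ^ n = 1) :
    u ∈ unitsOf S := by
  intro v _
  refine (pow_eq_one_iff.mp ?_).resolve_right hn
  rw [← map_pow, ← Units.val_pow_eq_pow_val, hu, Units.val_one, map_one]

variable (H : Subgroup Gal(K/k)) (i : (augRep S).IntertwiningMap (unitRep S))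

/-- The restriction of an equivariant map to the invariants. -/
noncomputable def fixedMap : fixedBy (augRep S) H →ₗ[ℤ] fixedBy (unitRep S) H :=
  i.toLinearMap.restrict fun x hx h => by
    change unitRep S h (i x) = i x
    rw [← i.isIntertwining, show augRep S h x = x from hx h]

/-- By injectivity, the image of the invariants is the trace of the whole image on the invariant
units, so finiteness of the index is inherited. -/
theorem index_range_fixedMap_ne_zero (hi : Function.Injective i)
    (hf : Finite (Additive (unitsOf S) ⧸ LinearMap.range i.toLinearMap)) :
    (fixedMap S H i).toAddMonoidHom.range.index ≠ 0 := by
  have hf' : Finite (Additive (unitsOf S) ⧸ i.toLinearMap.toAddMonoidHom.range) := hf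
  have h1 : i.toLinearMap.toAddMonoidHom.range.index ≠ 0 := Nat.card_pos.ne'
  have h2 : (fixedMap S H i).toAddMonoidHom.range =
      i.toLinearMap.toAddMonoidHom.range.comap (fixedBy (unitRep S) H).subtype.toAddMonoidHom := by
    ext u
    constructor
    · rintro ⟨x, rfl⟩
      exact ⟨x.1, rfl⟩
    · rintro ⟨x, hx⟩
      refine ⟨⟨x, fun h => hi ?_⟩, Subtype.ext hx⟩
      have h3 : i x = u := hx
      refine (i.isIntertwining _ _ _ _).trans ?_
      rw [h3]
      exact u.2 h
  rw [h2, AddSubgroup.index_comap]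
  exact fun h => h1 (AddSubgroup.index_eq_zero_of_relIndex_eq_zero h)

variable [NumberField k] [FiniteDimensional k K] [IsGalois k K]

theorem mem_fixedBy_unitRep_iff (u : Additive (unitsOf S)) :
    u ∈ fixedBy (unitRep S) H ↔ ((u.toMul : unitsOf S) : Kˣ) ∈ fixedUnits S H := by
  rw [mem_fixedUnits_iff]
  constructor
  · intro h
    refine ⟨u.toMul.2, fun g => ?_⟩
    exact congrArg (fun w : Additive (unitsOf S) => ((w.toMul : Kˣ) : K)) (h g)
  · rintro ⟨-, h⟩ g
    exact Additive.toMul.injective (Subtype.ext (Units.ext (h g)))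

/-- Roots of unity have trivial valuations and are therefore S-units for every S; conversely,
torsion S-units of the fixed field are integral. -/
theorem card_torsion_fixedBy_unitRep :
    Nat.card (Submodule.torsion ℤ (fixedBy (unitRep S) H)) = wNum H := by
  have hmem : ∀ ζ : Units.torsion (IntermediateField.fixedField H),
      ∃ u : fixedBy (unitRep S) H, u ∈ Submodule.torsion ℤ (fixedBy (unitRep S) H) ∧
        ((u.1.toMul : Kˣ) : K) = ((ζ : (𝓞 (IntermediateField.fixedField H))ˣ) :
          IntermediateField.fixedField H) := by
    rintro ⟨ζ, hζ⟩
    obtain ⟨n, hn, hζn⟩ := isOfFinOrder_iff_pow_eq_one.mp ((CommGroup.mem_torsion _).mp hζ)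
    let u : Kˣ := Units.map (algebraMap (𝓞 (IntermediateField.fixedField H)) K : _ →* K) ζ
    have hu : u ^ n = 1 := by rw [← map_pow, hζn, map_one]
    have hu' : u ∈ unitsOf S := mem_unitsOf_of_pow_eq_one S hn.ne' hu
    refine ⟨⟨Additive.ofMul ⟨u, hu'⟩, ?_⟩, ?_, rfl⟩
    · rw [mem_fixedBy_unitRep_iff, mem_fixedUnits_iff]
      exact ⟨hu', fun h => (ζ : IntermediateField.fixedField H).2 h⟩
    · refine (Submodule.mem_torsion_iff _).mpr
        ⟨⟨n, mem_nonZeroDivisors_of_ne_zero (by exact_mod_cast hn.ne')⟩, ?_⟩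
      apply Subtype.ext
      refine (natCast_zsmul _ n).trans ?_
      exact Additive.toMul.injective (Subtype.ext hu)
  choose f hf hfζ using hmem
  refine (Nat.card_congr (Equiv.ofBijective (fun ζ => (⟨f ζ, hf ζ⟩ :
    Submodule.torsion ℤ (fixedBy (unitRep S) H))) ⟨fun ζ ξ h => ?_, ?_⟩)).symm
  · apply Subtype.ext
    apply Units.ext
    apply RingOfIntegers.ext
    refine FaithfulSMul.algebraMap_injective (IntermediateField.fixedField H) K ?_
    exact (hfζ ζ).symm.trans ((congrArg (fun u => ((u.1.1.toMul : Kˣ) : K)) h).trans (hfζ ξ))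
  · rintro ⟨u, hu⟩
    obtain ⟨⟨m, hm⟩, hmu⟩ := (Submodule.mem_torsion_iff _).mp hu
    obtain ⟨x, -, hx⟩ := (mem_fixedBy_unitRep_iff S H u.1).mp u.2
    have h1 : ((u.1.toMul : unitsOf S) : Kˣ) ^ m = 1 :=
      congrArg (fun w : fixedBy (unitRep S) H => ((w.1.toMul : unitsOf S) : Kˣ)) hmu
    obtain ⟨n, hn, h2⟩ := isOfFinOrder_iff_pow_eq_one.mp
      (isOfFinOrder_iff_zpow_eq_one.mpr ⟨m, nonZeroDivisors.ne_zero hm, h1⟩)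
    have h3 : x ^ n = 1 := by
      refine Units.map_injective
        (FaithfulSMul.algebraMap_injective (IntermediateField.fixedField H) K) ?_
      rw [map_pow, map_one]
      exact (congrArg (· ^ n) hx).trans h2
    have h4 : (x : IntermediateField.fixedField H) ^ n = 1 := congrArg Units.val h3
    let y : 𝓞 (IntermediateField.fixedField H) :=
      ⟨x, IsIntegral.of_pow hn (by rw [h4]; exact isIntegral_one)⟩
    have h5 : y ^ n = 1 := RingOfIntegers.ext h4
    let ζ := Units.ofPowEqOne y n h5 hn.ne'
    have hζ : ζ ∈ Units.torsion (IntermediateField.fixedField H) :=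
      (CommGroup.mem_torsion _).mpr (isOfFinOrder_iff_pow_eq_one.mpr ⟨n, hn, Units.ext h5⟩)
    refine ⟨⟨ζ, hζ⟩, Subtype.ext (Subtype.ext (Additive.toMul.injective
      (Subtype.ext (Units.ext ((hfζ ⟨ζ, hζ⟩).trans ?_)))))⟩
    exact congrArg Units.val hx

/-- Injectivity and equivariance identify `i(I)^H` with `i(I^H)`. This connects the index inside
`Kˣ` from the statement with the additive index in the determinant formula. -/
theorem index_range_fixedMap (hi : Function.Injective i) :
    (fixedMap S H i).toAddMonoidHom.range.index = (fixedImage S H i).relIndex (fixedUnits S H) := by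
  let ψ : Multiplicative (fixedBy (unitRep S) H) →* Kˣ :=
    (unitsOf S).subtype.comp (AddMonoidHom.toMultiplicativeLeft
      (fixedBy (unitRep S) H).subtype.toAddMonoidHom)
  have h1 : ψ.range = fixedUnits S H := by
    ext u
    constructor
    · rintro ⟨x, rfl⟩
      exact (mem_fixedBy_unitRep_iff S H _).mp x.toAdd.2
    · intro hu
      exact ⟨Multiplicative.ofAdd ⟨Additive.ofMul ⟨u, ((mem_fixedUnits_iff H S u).mp hu).1⟩,
        (mem_fixedBy_unitRep_iff S H _).mpr hu⟩, rfl⟩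
  have h2 : (fixedImage S H i).comap ψ =
      AddSubgroup.toSubgroup (fixedMap S H i).toAddMonoidHom.range := by
    ext u
    constructor
    · rintro ⟨⟨_, ⟨x, rfl⟩, hx⟩, -⟩
      have h3 : i x.toAdd = (u.toAdd : Additive (unitsOf S)) :=
        Additive.toMul.injective (Subtype.ext hx)
      refine ⟨⟨x.toAdd, fun h => hi ?_⟩, Subtype.ext h3⟩
      refine (i.isIntertwining _ _ _ _).trans ?_
      rw [h3]
      exact u.toAdd.2 h
    · rintro ⟨x, hx⟩
      refine ⟨⟨_, ⟨Multiplicative.ofAdd x.1, rfl⟩, ?_⟩, fun g => Units.ext ?_⟩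
      · exact congrArg (fun w : fixedBy (unitRep S) H => (w.1.toMul : Kˣ)) hx
      · exact ((mem_fixedUnits_iff H S _).mp
          ((mem_fixedBy_unitRep_iff S H _).mp u.toAdd.2)).2 g
  rw [← h1, ← Subgroup.index_comap, h2, AddSubgroup.index_toSubgroup]

theorem sClassNumber_ne_zero {F : Type*} [Field F] [NumberField F] (T : Set (Place F)) :
    sClassNumber T ≠ 0 := Nat.card_pos.ne'

theorem lLcm_ne_zero [Finite S] : lLcm S H ≠ 0 := by
  intro h
  have h1 := (lLcm_dvd_iff H S (Nat.card H)).mpr fun ω => ⟨_, (orbitDegree_mul S H ω).symm⟩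
  rw [h, zero_dvd_iff] at h1
  exact Nat.card_pos.ne' h1

theorem nProd_ne_zero [Finite S] : nProd S H ≠ 0 := by
  have := Fintype.ofFinite S
  rw [nProd_eq]
  exact_mod_cast degreeProd_ne_zero S H

variable [Finite S]

theorem latticeDet_fixed_comp (hi : Function.Injective i)
    (hf : Finite (Additive (unitsOf S) ⧸ LinearMap.range i.toLinearMap))
    (B : Additive (unitsOf S) →ₗ[ℤ] Additive (unitsOf S) →ₗ[ℤ] ℂ) (c : ℂ) :
    latticeDet (fixedBy (augRep S) H) (c • (B.compl₁₂ i.toLinearMap i.toLinearMap).domRestrict₁₂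
      (fixedBy (augRep S) H) (fixedBy (augRep S) H)) =
      (((fixedImage S H i).relIndex (fixedUnits S H) : ℂ) / wNum H) ^ 2 *
        latticeDet (fixedBy (unitRep S) H)
          (c • B.domRestrict₁₂ (fixedBy (unitRep S) H) (fixedBy (unitRep S) H)) := by
  have h1 := latticeDet_comap (c • B.domRestrict₁₂ (fixedBy (unitRep S) H)
    (fixedBy (unitRep S) H)) (φ := fixedMap S H i)
    (fun x y h => Subtype.ext (hi (congrArg Subtype.val h)))
    (index_range_fixedMap_ne_zero S H i hi hf)
  rw [card_torsion_fixedBy_unitRep, index_range_fixedMap S H i hi] at h1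
  have hw : (wNum H : ℂ) ≠ 0 := Nat.cast_ne_zero.mpr (Units.torsionOrder_ne_zero _)
  rw [div_pow, div_mul_eq_mul_div, eq_div_iff (pow_ne_zero _ hw), ← h1]
  rfl

variable [Fintype (Subgroup Gal(K/k))] {Θ : Subgroup Gal(K/k) → ℤ}

theorem prod_regulatorConstant_decompositionGroup (hΘ : IsBrauerRelation Θ)
    (P : placesBelow k (S : Set (Place K)) → S) (hP : ∀ p, Place.below k (P p : Place K) = p) :
    ∏ᶠ p, regulatorConstant
      (Representation.ofMulAction ℤ Gal(K/k) (Gal(K/k) ⧸ decompositionGroup (P p))) Θ =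
        ∏ H, ((nProd S H : ℂ)⁻¹) ^ Θ H := by
  have := Fintype.ofFinite S
  simp only [nProd_eq]
  refine prod_regulatorConstant_transversal P (fun x => ?_) (fun p q h => ?_) _ (fun p => ?_) hΘ
  · obtain ⟨g, hg⟩ := (below_eq_iff (F := k) _ _).mp (hP ⟨_, x, x.2, rfl⟩)
    exact ⟨_, g, Subtype.ext hg⟩
  · obtain ⟨g, hg⟩ := h
    apply Subtype.ext
    rw [← hP p, ← hP q]
    exact (below_eq_iff _ _).mpr ⟨g, congrArg Subtype.val hg⟩
  · ext g
    rw [MulAction.mem_stabilizer_iff, MulAction.mem_stabilizer_iff, Subtype.ext_iff]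
    rfl

theorem regulatorConstant_augRep (hΘ : IsBrauerRelation Θ) [Nonempty S] :
    regulatorConstant (augRep S) Θ =
      regulatorConstant (Representation.trivial ℤ Gal(K/k) ℤ) Θ *
        ∏ H, ((lLcm S H : ℂ) ^ 2 / nProd S H) ^ Θ H := by
  have := Fintype.ofFinite S
  simp only [nProd_eq]
  exact regulatorConstant_augKernel (X := S) (augKernel S) rfl (fun H d => lLcm_dvd_iff H S d) hΘ

/-- A pairing on the units pulls back along `i` to an invariant one, non-degenerate because the
image has finite index. Computing both constants with these pairings leaves only the index factors.
-/
theorem regulatorConstant_unitRep (hΘ : IsBrauerRelation Θ) (hi : Function.Injective i)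
    (hf : Finite (Additive (unitsOf S) ⧸ LinearMap.range i.toLinearMap)) :
    regulatorConstant (augRep S) Θ = regulatorConstant (unitRep S) Θ *
      ∏ H, (((fixedImage S H i).relIndex (fixedUnits S H) : ℂ) / wNum H) ^ (2 * Θ H) := by
  obtain ⟨B, hB⟩ := exists_isInvariantPairing (unitRep S)
  have hB' : IsInvariantPairing (augRep S) (B.compl₁₂ i.toLinearMap i.toLinearMap) := by
    constructor
    · intro g x y
      change B (i (augRep S g x)) (i (augRep S g y)) = B (i x) (i y)
      rw [i.isIntertwining, i.isIntertwining, hB.1]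
    · have hf' : Finite (Additive (unitsOf S) ⧸ i.toLinearMap.toAddMonoidHom.range) := hf
      have h1 : i.toLinearMap.toAddMonoidHom.range.index ≠ 0 := Nat.card_pos.ne'
      have h2 := latticeDet_comap B (φ := i.toLinearMap) hi h1
      refine left_ne_zero_of_mul (h2.trans_ne (mul_ne_zero ?_ hB.2))
      exact pow_ne_zero _ (Nat.cast_ne_zero.mpr h1)
  rw [regulatorConstant_eq hΘ hB, regulatorConstant_eq hΘ hB', ← Finset.prod_mul_distrib]
  refine Finset.prod_congr rfl fun H _ => ?_
  rw [latticeDet_fixed_comp S H i hi hf B, zpow_mul, mul_zpow, zpow_ofNat, mul_comm]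

end Units
end FactorReg

/-! ### The main theorem. -/

open FactorReg in
theorem mainTheorem5 {k K : Type*} [Field k] [NumberField k] [Field K] [NumberField K]
    [Algebra k K] [FiniteDimensional k K] [IsGalois k K]
    (S : SubMulAction Gal(K/k) (Place K)) [Finite S]
    (hS : ∀ v : InfinitePlace K, (Sum.inl v : Place K) ∈ S)
    (P : placesBelow k (S : Set (Place K)) → S)
    (hP : ∀ p, Place.below k (P p : Place K) = p) :
    (∀ Θ : Subgroup Gal(K/k) → ℤ, IsBrauerRelation Θ →
      regulatorConstant (augRep S) Θ =
        regulatorConstant (Representation.trivial ℤ Gal(K/k) ℤ) Θ /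
          (∏ᶠ p, regulatorConstant
            (Representation.ofMulAction ℤ Gal(K/k) (Gal(K/k) ⧸ decompositionGroup (P p))) Θ) *
        ∏ᶠ H : Subgroup Gal(K/k), ((lLcm S H : ℂ) / nProd S H) ^ (2 * Θ H)) ∧
    ∀ i : (augRep S).IntertwiningMap (unitRep S), Function.Injective i →
      Finite (Additive (unitsOf S) ⧸ LinearMap.range i.toLinearMap) →
      ((∃ f : Subgroup Gal(K/k) → ℚˣ,
          (∀ H, (f H : ℚ) = (fixedImage S H i).relIndex (fixedUnits S H) *
            (nProd S H / (hNum S H * lLcm S H))) ∧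
          IsFactorisable f) ↔
        ∀ Θ : Subgroup Gal(K/k) → ℤ, IsBrauerRelation Θ →
          regulatorConstant (unitRep S) Θ =
            regulatorConstant (Representation.trivial ℤ Gal(K/k) ℤ) Θ /
              (∏ᶠ p, regulatorConstant
                (Representation.ofMulAction ℤ Gal(K/k) (Gal(K/k) ⧸ decompositionGroup (P p))) Θ) *
            ∏ᶠ H : Subgroup Gal(K/k), ((wNum H : ℂ) / hNum S H) ^ (2 * Θ H)) := by
  have := Fintype.ofFinite (Subgroup Gal(K/k))
  -- K has an Archimedean place, so S is nonempty and the augmentation is nonzero.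
  have hne : Nonempty S := ⟨⟨_, hS (Classical.arbitrary _)⟩⟩
  have hl : ∀ H, (lLcm S H : ℂ) ≠ 0 := fun H => Nat.cast_ne_zero.mpr (lLcm_ne_zero S H)
  have hn : ∀ H, (nProd S H : ℂ) ≠ 0 := fun H => Nat.cast_ne_zero.mpr (nProd_ne_zero S H)
  have hh : ∀ H, (hNum S H : ℂ) ≠ 0 := fun H => Nat.cast_ne_zero.mpr (sClassNumber_ne_zero _)
  have hw : ∀ H : Subgroup Gal(K/k), (wNum H : ℂ) ≠ 0 := fun H =>
    Nat.cast_ne_zero.mpr (Units.torsionOrder_ne_zero _)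
  constructor
  · intro Θ hΘ
    rw [prod_regulatorConstant_decompositionGroup S hΘ P hP, regulatorConstant_augRep S hΘ,
      finprod_eq_prod_of_fintype, div_mul_eq_mul_div, mul_div_assoc, ← Finset.prod_div_distrib]
    congr 1
    refine Finset.prod_congr rfl fun H _ => ?_
    rw [zpow_mul, ← div_zpow]
    congr 1
    have := hn H
    rw [zpow_ofNat]
    field_simp
  · intro i hi hf
    have hr : ∀ H, (((fixedImage S H i).relIndex (fixedUnits S H) : ℕ) : ℂ) ≠ 0 := fun H =>
      Nat.cast_ne_zero.mpr (by
        rw [← index_range_fixedMap S H i hi]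
        exact index_range_fixedMap_ne_zero S H i hi hf)
    let q : Subgroup Gal(K/k) → ℚ := fun H => (fixedImage S H i).relIndex (fixedUnits S H) *
      (nProd S H / (hNum S H * lLcm S H))
    have hq : ∀ H, 0 < q H := by
      intro H
      have h1 := Nat.cast_ne_zero.mp (hr H)
      have h2 := lLcm_ne_zero S H
      have h3 := nProd_ne_zero S H
      have h4 : hNum S H ≠ 0 := sClassNumber_ne_zero _
      positivity
    have key : ∀ Θ : Subgroup Gal(K/k) → ℤ, IsBrauerRelation Θ →
        (∏ H, q H ^ Θ H = 1 ↔ regulatorConstant (unitRep S) Θ =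
            regulatorConstant (Representation.trivial ℤ Gal(K/k) ℤ) Θ /
              (∏ᶠ p, regulatorConstant
                (Representation.ofMulAction ℤ Gal(K/k) (Gal(K/k) ⧸ decompositionGroup (P p))) Θ) *
            ∏ᶠ H : Subgroup Gal(K/k), ((wNum H : ℂ) / hNum S H) ^ (2 * Θ H)) := by
      intro Θ hΘ
      have h1 := regulatorConstant_unitRep S i hΘ hi hf
      rw [regulatorConstant_augRep S hΘ] at h1
      have h2 : regulatorConstant (Representation.trivial ℤ Gal(K/k) ℤ) Θ ≠ 0 := by
        rw [regulatorConstant_trivial hΘ one_ne_zero]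
        exact Finset.prod_ne_zero_iff.mpr fun H _ => zpow_ne_zero _
          (one_div_ne_zero (Nat.cast_ne_zero.mpr Nat.card_pos.ne'))
      rw [prod_regulatorConstant_decompositionGroup S hΘ P hP, finprod_eq_prod_of_fintype]
      set t := regulatorConstant (Representation.trivial ℤ Gal(K/k) ℤ) Θ
      set A := ∏ H, (((fixedImage S H i).relIndex (fixedUnits S H) : ℂ) / wNum H) ^ (2 * Θ H)
      have hA : A ≠ 0 := Finset.prod_ne_zero_iff.mpr fun H _ =>
        zpow_ne_zero _ (div_ne_zero (hr H) (hw H))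
      -- Factor by factor, both sides equal `r² n / h²`, with `q = r n / (h l)`.
      have h3 : ((∏ H, q H ^ Θ H : ℚ) : ℂ) ^ 2 * (∏ H, ((lLcm S H : ℂ) ^ 2 / nProd S H) ^ Θ H) =
          A * ((∏ H, ((nProd S H : ℂ)⁻¹) ^ Θ H)⁻¹ * ∏ H, ((wNum H : ℂ) / hNum S H) ^ (2 * Θ H)) := by
        push_cast
        simp only [A]
        rw [← Finset.prod_pow, ← Finset.prod_mul_distrib, ← Finset.prod_inv_distrib,
          ← Finset.prod_mul_distrib, ← Finset.prod_mul_distrib]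
        refine Finset.prod_congr rfl fun H _ => ?_
        have := hl H
        have := hn H
        have := hh H
        have := hw H
        rw [← zpow_natCast, zpow_comm, ← mul_zpow, zpow_mul, zpow_mul, ← inv_zpow, ← mul_zpow,
          ← mul_zpow]
        congr 1
        simp only [q]
        push_cast
        rw [zpow_ofNat, zpow_ofNat, zpow_ofNat]
        field_simp
      have h4 : (∏ H, ((lLcm S H : ℂ) ^ 2 / nProd S H) ^ Θ H) ≠ 0 :=
        Finset.prod_ne_zero_iff.mpr fun H _ =>
          zpow_ne_zero _ (div_ne_zero (pow_ne_zero _ (hl H)) (hn H))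
      have h5 : 0 < ∏ H, q H ^ Θ H := Finset.prod_pos fun H _ => zpow_pos (hq H) _
      -- After multiplication by A, the two sides of (b) differ by the square of `∏ q(H)^Θ(H)`;
      -- since that product is positive, its square is 1 only if it is 1.
      rw [← mul_left_inj' hA, ← h1, div_eq_mul_inv, mul_assoc, mul_assoc, mul_right_inj' h2,
        mul_comm _ A, mul_left_comm _ A, ← h3, right_eq_mul₀ h4, ← Rat.cast_pow,
        ← Rat.cast_one (α := ℂ), Rat.cast_inj, pow_eq_one_iff_of_nonneg h5.le two_ne_zero]
    constructor
    · rintro ⟨f, hf, hfac⟩ Θ hΘ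
      rw [← key Θ hΘ, ← Units.val_one, ← (isFactorisable_iff f).mp hfac Θ hΘ]
      simp [q, hf]
    · intro hb
      refine ⟨fun H => Units.mk0 (q H) (hq H).ne', fun H => rfl,
        (isFactorisable_iff _).mpr fun Θ hΘ => Units.ext ?_⟩
      simpa using (key Θ hΘ).mpr (hb Θ hΘ)
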